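/- Let $p,q$ be relatively prime positive integers, let $f:\mathbb R\to\mathbb R$ be $C^\infty$ and 1-periodic, let $\alpha>0$ and $\lambda\in[0,1]$. Let $g_\lambda=\phi*b_\lambda$, where $\phi(x)=\sqrt{\alpha/\pi}\,e^{-\alpha x^2}$ and $b_\lambda$ is the 1-periodic block function equal to $1$ on $[0,\lambda)$ and to $0$ on $[\lambda,1)$. Write $f_k$ and $g_k(\lambda)$ for the Fourier coefficients of $f$ and $g_\lambda$ with respect to $e^{2\pi i k t}$. Then $g_0(\lambda)=\lambda$ and, for $k\neq 0$, $$g_k(\lambda)=e^{-\pi^2k^2/\alpha}\,\frac{i}{2\pi k}\bigl(e^{-2\pi i k\lambda}-1\bigr).$$ Consider the seasonal oscillator (lifted to $\mathbb R^2$) $$\dot x=\omega+\eta f(x)+\varepsilon g_\lambda(y),\qquad \dot y=1,$$ and let $\sigma$ have degree $2$, $\eta,\varepsilon$ degree $1$, $x,y$ degree $0$. Put $$W_{\eta,\varepsilon}(u)=-\frac qp\Bigl(\eta^2\sum_{k\ne0}f_kf_{-k}+\varepsilon\eta\sum_{m\neq0}f_{mq}\,g_{-mp}(\lambda)\,e^{2\pi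 i mqu}\Bigr),$$ where both series converge absolutely and $W$ is real. (a) If the means of $f$ and $g_\lambda$ are absorbed in the frequency, $\omega+\eta f_0+\varepsilon\lambda=\frac pq+\sigma$ (equivalently, $\omega=\frac pq+\sigma$ and $f$, $g_\lambda$ are replaced by $f-f_0$, $g_\lambda-\lambda$), then the vector field approximation up to degree two of the Poincaré map is $$\dot u=\sigma+W_{\eta,\varepsilon}(u),\qquad u=x-\tfrac pq y .$$ (b) If $\omega=\frac pq+\sigma$, with no condition on the means, it is $$\dot u=\sigma+\eta f_0+\varepsilon\lambda+W_{\eta,\varepsilon}(u),\qquad u=x-\tfrac pq y.$$ Here, for a system $\dot x=X(x,y)$, $\dot y=1$ depending on the parameters, with flow $\Phi_t$, the Poincaré map $F$ is given by $(F(x),1)=\Phi_1(x,0)$. That $\dot u=Z(u)$ is its vector field approximation up to degree two means the following. $Z$ is $\frac1q$-periodic, and there is a $C^\infty$ near-identity change of coordinates $\xi=x+a(x,y)$, with $a$ depending smoothly on $(\sigma,\eta,\varepsilon)$, 1-periodic in $x$ and in $y$, zero at zero parameters, and such that its parts linear in $\eta$ and in $\varepsilon$ have no Fourier terms $e^{2\pi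 i(kx+ly)}$ with $pk+ql=0$. For all sufficiently small parameters $x\mapsto\xi$ is a diffeomorphism for each $y$, and uniformly in $x,y$ $$\dot\xi=\tfrac pq+Z\bigl(\xi-\tfrac pqy\bigr)+O(\rho^3),\qquad \rho=|\sigma|^{1/2}+|\eta|+|\varepsilon| .$$ Moreover, with $h(x)=x+a(x,0)$ and $\psi_q$ the time-$q$ map of the flow of $Z$, one has $h(F^q(x))-p=\psi_q(h(x))+O(\rho^3)$ uniformly in $x$. -/

import Mathlib

open scoped ContDiff

noncomputable section

/-! ### The forcing -/

/-- The `1`-periodic block function: `1` on `[0, l)` and `0` on `[l, 1)`. -/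
def blockForcing (l : ℝ) (t : ℝ) : ℝ :=
  if Int.fract t < l then 1 else 0

/-- The normalized Gaussian `√(α / π) exp (-α x²)`. -/
def gaussKernel (α : ℝ) (x : ℝ) : ℝ :=
  Real.sqrt (α / Real.pi) * Real.exp (-α * x ^ 2)

/-- The smoothed block function, the convolution of `gaussKernel α` and `blockForcing l`. -/
def smoothForcing (α l : ℝ) : ℝ → ℝ :=
  MeasureTheory.convolution (gaussKernel α) (blockForcing l)
    (ContinuousLinearMap.mul ℝ ℝ) MeasureTheory.volume

/-- The `k`-th Fourier coefficient `∫₀¹ h(t) exp (-2πikt) dt` of a `1`-periodic real function. -/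
def fourierCoef (h : ℝ → ℝ) (k : ℤ) : ℂ :=
  fourierCoeffOn (zero_lt_one' ℝ) (fun t => (h t : ℂ)) k

/-! ### Flows and Poincaré maps -/

/-- `Φ` is the time-`T` map of the flow of the autonomous vector field `V`, for `0 ≤ T`. -/
def IsFlowMap {E : Type*} [NormedAddCommGroup E] [NormedSpace ℝ E]
    (V : E → E) (T : ℝ) (Φ : E → E) : Prop :=
  ∀ z : E, ∃ γ : ℝ → E,
    γ 0 = z ∧ IsIntegralCurveOn γ (fun _ => V) (Set.Icc 0 T) ∧ γ T = Φ z

/-- The planar vector field of the system `x' = X x y`, `y' = 1`. -/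
def forcedField (X : ℝ → ℝ → ℝ) (z : ℝ × ℝ) : ℝ × ℝ :=
  (X z.1 z.2, 1)

/-- `F` is the (lift of the) Poincaré map of `x' = X x y`, `y' = 1`, that is
`(F x, 1) = Φ₁ (x, 0)` for the flow `Φ` of the system. -/
def IsPoincareMap (X : ℝ → ℝ → ℝ) (F : ℝ → ℝ) : Prop :=
  ∃ Φ : ℝ × ℝ → ℝ × ℝ, IsFlowMap (forcedField X) 1 Φ ∧ ∀ x, Φ (x, 0) = (F x, 1)

/-! ### Vector field approximation of a Poincaré map

Parameters are triples `P = (σ, η, ε)`. The grading comes from the parameters only: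
`σ` has degree two, `η` and `ε` have degree one, `x` and `y` have degree zero. -/

/-- The quasi-norm of the grading: a monomial in `(σ, η, ε)` of degree `d` is at most
`paramSize P ^ d` in absolute value. -/
def paramSize (P : ℝ × ℝ × ℝ) : ℝ :=
  Real.sqrt |P.1| + |P.2.1| + |P.2.2|

/-- The function `b(x, y)`, `1`-periodic in both variables, has no resonant Fourier terms, i.e. no
terms `exp (2πi(kx + ly))` with `pk + ql = 0`. Equivalently, its averages over the closed orbits
`t ↦ (x + (p/q)t, t)`, `0 ≤ t ≤ q`, of the field `(p/q, 1)` on the torus vanish. -/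
def NoResonantTerms (p q : ℕ) (b : ℝ → ℝ → ℝ) : Prop :=
  ∀ x : ℝ, ∫ t in (0 : ℝ)..(q : ℝ), b (x + (p : ℝ) / q * t) t = 0

/-- `u' = Z P u` is the vector field approximation up to degree two of the Poincaré map of the
family `x' = X P x y`, `y' = 1` near the frequency `p / q`.

There is a smooth near-identity transformation `ξ = x + a P x y`, `y` unchanged, of lifts of maps
of the two-torus, generated in degree one by nonresonant terms, that takes the system to
`ξ' = p/q + Z P (ξ - (p/q)y) + (terms of degree at least three)`. Here `Z P (ξ - (p/q)y)` has only
resonant terms (is `1`-periodic also in `y`), and `u = ξ - (p/q)y`.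
Moreover, in the new coordinate, `F^q - p` is the time-`q` map of the flow of `Z P`, up to terms of
degree at least three, where `F` is the Poincaré map. -/
def IsVectorFieldApprox (p q : ℕ) (X : ℝ × ℝ × ℝ → ℝ → ℝ → ℝ) (Z : ℝ × ℝ × ℝ → ℝ → ℝ) : Prop :=
  (∀ P, Function.Periodic (Z P) (1 / (q : ℝ))) ∧
  ∃ a : ℝ × ℝ × ℝ → ℝ → ℝ → ℝ,
    ContDiff ℝ ∞ (fun w : (ℝ × ℝ × ℝ) × ℝ × ℝ => a w.1 w.2.1 w.2.2) ∧
    (∀ P x y, a P (x + 1) y = a P x y ∧ a P x (y + 1) = a P x y) ∧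
    (∀ x y, a 0 x y = 0) ∧
    NoResonantTerms p q (fun x y => deriv (fun s : ℝ => a (0, s, 0) x y) 0) ∧
    NoResonantTerms p q (fun x y => deriv (fun s : ℝ => a (0, 0, s) x y) 0) ∧
    ∃ r : ℝ, 0 < r ∧ ∃ C : ℝ, ∀ P, paramSize P ≤ r →
      -- for each `y` the map `x ↦ x + a P x y` is a diffeomorphism
      (∀ x y, 0 < 1 + deriv (fun x' => a P x' y) x) ∧
      -- the transformed vector field, whose first component is `ξ'`
      (∀ x y,
        |X P x y * (1 + deriv (fun x' => a P x' y) x) + deriv (fun y' => a P x y') y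
          - ((p : ℝ) / q + Z P (x + a P x y - (p : ℝ) / q * y))| ≤ C * paramSize P ^ 3) ∧
      -- the Poincaré map
      ∃ F ψ : ℝ → ℝ, IsPoincareMap (X P) F ∧ IsFlowMap (Z P) q ψ ∧
        ∀ x, |(F^[q] x + a P (F^[q] x) 0 - p) - ψ (x + a P x 0)| ≤ C * paramSize P ^ 3

end

/-! The proof is second-order averaging along the closed orbits of `(p / q, 1)`, all of period `q`.
The equation `(p / q) ∂ₓ c + ∂ᵧ c = b - orbitAvg p q b` has an explicit smooth biperiodic solution
`homSol`, an integral along the orbit, so no small divisors appear (`hasDerivAt_homSol_orbit`,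
`noResonantTerms_homSol`).

Write `f₀` for the mean of `f`. The change `-η H₁ - ε H₂`, where `H₁`, `H₂` solve the equation for
`f x` and `g y`, reduces the linear terms to their means. As `H₁` depends on `x` only and `H₂` on
`y` only, its `x`-derivative is `-η (q / p) (f - f₀)`. Multiplied by `η f + ε g`, this leaves the
quadratic terms `-(q / p) (η² f (f - f₀) + ε η g (f - f₀))`. A quadratic correction replaces them by
their orbit averages, and what remains is cubic (`abs_averaging_remainder_le`,
`isVectorFieldApprox_averagedTerm`). Grönwall's inequality over time `q` carries the estimate over
to the Poincaré map (`iterate_poincareMap_sub_flow_le`).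

The averages become the stated series by integrating the Fourier series of `f - f₀` along an orbit:
against `f` this is Parseval, and against `g` only the frequencies `k = m q` survive, by coprimality
(`hasSum_resonant`). Convolution multiplies the coefficients of the block by a Gaussian factor,
which gives `g_k` and the smoothness of the forcing. Case (b) is the averaging theorem itself; (a)
is the same theorem for the centred functions, whose quadratic average is unchanged
(`averagedTerm_sub_mean`). -/

/-! ### Smoothness of parametric integrals -/

theorem hasFDerivAt_intervalIntegral_param {E G : Type} [NormedAddCommGroup E] [NormedSpace ℝ E]
    [FiniteDimensional ℝ E] [NormedAddCommGroup G] [NormedSpace ℝ G]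
    {F : E × ℝ → G} (hF : ContDiff ℝ 1 F) (a b : ℝ) (x : E) :
    HasFDerivAt (fun x => ∫ s in a..b, F (x, s))
      (∫ s in a..b, (fderiv ℝ F (x, s)).comp (ContinuousLinearMap.inl ℝ E ℝ)) x := by
  have hF' : Continuous fun z : E × ℝ =>
      (fderiv ℝ F z).comp (ContinuousLinearMap.inl ℝ E ℝ) :=
    (hF.continuous_fderiv one_ne_zero).clm_comp continuous_const
  -- Finite dimension makes the closed unit ball compact, so the partial derivative has a constant
  -- dominating bound there.
  have hK : IsCompact (Metric.closedBall x 1 ×ˢ Set.uIcc a b) :=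
    (isCompact_closedBall x 1).prod isCompact_uIcc
  obtain ⟨C, hC⟩ := hK.exists_bound_of_continuousOn hF'.continuousOn
  refine intervalIntegral.hasFDerivAt_integral_of_dominated_of_fderiv_le
    (F' := fun x s => (fderiv ℝ F (x, s)).comp (ContinuousLinearMap.inl ℝ E ℝ))
    (bound := fun _ => C) (Metric.closedBall_mem_nhds x one_pos)
    (Filter.Eventually.of_forall fun y => ?_) ?_ ?_ ?_ ?_ ?_
  · exact (hF.continuous.comp (by fun_prop : Continuous fun s : ℝ => (y, s))).aestronglyMeasurable
  · exact (hF.continuous.comp (by fun_prop : Continuous fun s : ℝ => (x, s))).intervalIntegrable _ _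
  · exact (hF'.comp (by fun_prop : Continuous fun s : ℝ => (x, s))).aestronglyMeasurable
  · exact Filter.Eventually.of_forall fun t ht y hy =>
      hC (y, t) ⟨hy, Set.uIoc_subset_uIcc ht⟩
  · exact intervalIntegrable_const
  · refine Filter.Eventually.of_forall fun t _ y _ => ?_
    exact ((hF.differentiable one_ne_zero (y, t)).hasFDerivAt).comp y (hasFDerivAt_prodMk_left y t)

/-- The target `G` is quantified inside the induction because the derivative is an integral of the
same kind with values in `E →L[ℝ] G`. -/
theorem contDiff_nat_intervalIntegral_param {E : Type} [NormedAddCommGroup E] [NormedSpace ℝ E]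
    [FiniteDimensional ℝ E] (a b : ℝ) (n : ℕ) :
    ∀ {G : Type} [NormedAddCommGroup G] [NormedSpace ℝ G]
    {F : E × ℝ → G}, ContDiff ℝ ∞ F → ContDiff ℝ n (fun x => ∫ s in a..b, F (x, s)) := by
  induction n with
  | zero =>
    intro G _ _ F hF
    rw [Nat.cast_zero, contDiff_zero]
    exact continuous_iff_continuousAt.2 fun x =>
      (hasFDerivAt_intervalIntegral_param (hF.of_le (by simp)) a b x).continuousAt
  | succ n ih =>
    intro G _ _ F hF
    have h := hasFDerivAt_intervalIntegral_param (hF.of_le (by simp)) a b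
    rw [Nat.cast_succ, contDiff_succ_iff_fderiv]
    refine ⟨fun x => (h x).differentiableAt, by simp, ?_⟩
    rw [funext fun x => (h x).fderiv]
    exact ih (F := fun z => (fderiv ℝ F z).comp (ContinuousLinearMap.inl ℝ E ℝ))
      ((hF.fderiv_right (m := ∞) (by simp)).clm_comp contDiff_const)

theorem contDiff_intervalIntegral_param {E G : Type} [NormedAddCommGroup E] [NormedSpace ℝ E]
    [FiniteDimensional ℝ E] [NormedAddCommGroup G] [NormedSpace ℝ G]
    {F : E × ℝ → G} (hF : ContDiff ℝ ∞ F) (a b : ℝ) :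
    ContDiff ℝ ∞ (fun x => ∫ s in a..b, F (x, s)) :=
  contDiff_infty.2 fun n => contDiff_nat_intervalIntegral_param a b n hF

/-! ### Averages over the closed orbits and the homological equation -/

/-- The average of `b` over the orbit of the field `(p / q, 1)` through `z`. -/
noncomputable def orbitAvg (p q : ℕ) (b : ℝ × ℝ → ℝ) (z : ℝ × ℝ) : ℝ :=
  1 / (q : ℝ) * ∫ s in (0 : ℝ)..q, b (z.1 + (p : ℝ) / q * s, z.2 + s)

/-- The nonresonant solution `c` of `(p / q) ∂ₓ c + ∂ᵧ c = b - orbitAvg p q b`. -/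
noncomputable def homSol (p q : ℕ) (b : ℝ × ℝ → ℝ) (z : ℝ × ℝ) : ℝ :=
  1 / (q : ℝ) * (∫ s in (0 : ℝ)..q, s * b (z.1 + (p : ℝ) / q * s, z.2 + s))
    - (q : ℝ) / 2 * orbitAvg p q b z

/-- `b` is `1`-periodic in both variables. -/
noncomputable def Biperiodic (b : ℝ × ℝ → ℝ) : Prop :=
  ∀ x y, b (x + 1, y) = b (x, y) ∧ b (x, y + 1) = b (x, y)

theorem Biperiodic.add_natCast {b : ℝ × ℝ → ℝ} (hb : Biperiodic b) (x y : ℝ) (m n : ℕ) :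
    b (x + m, y + n) = b (x, y) := by
  have h1 : Function.Periodic (fun x => b (x, y + n)) 1 := fun x => (hb x _).1
  have h2 : Function.Periodic (fun y => b (x, y)) 1 := fun y => (hb x y).2
  have h3 := h1.nat_mul m x
  have h4 := h2.nat_mul n y
  simp only [mul_one] at h3 h4
  rw [h3, h4]

section OrbitAverage

variable {p q : ℕ} {b : ℝ × ℝ → ℝ}

theorem contDiff_orbitAvg (hb : ContDiff ℝ ∞ b) : ContDiff ℝ ∞ (orbitAvg p q b) := by
  unfold orbitAvg
  refine contDiff_const.mul (contDiff_intervalIntegral_param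
    (F := fun w : (ℝ × ℝ) × ℝ => b (w.1.1 + (p : ℝ) / q * w.2, w.1.2 + w.2)) ?_ _ _)
  exact hb.comp (by fun_prop)

theorem contDiff_homSol (hb : ContDiff ℝ ∞ b) : ContDiff ℝ ∞ (homSol p q b) := by
  unfold homSol
  refine (contDiff_const.mul (contDiff_intervalIntegral_param
    (F := fun w : (ℝ × ℝ) × ℝ => w.2 * b (w.1.1 + (p : ℝ) / q * w.2, w.1.2 + w.2)) ?_ _ _)).sub
    (contDiff_const.mul (contDiff_orbitAvg hb))
  exact contDiff_snd.mul (hb.comp (by fun_prop))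

theorem Biperiodic.orbitAvg (hb : Biperiodic b) : Biperiodic (orbitAvg p q b) := by
  intro x y
  simp only [_root_.orbitAvg, add_right_comm x 1, add_right_comm y 1]
  constructor <;> congr 1 <;> refine intervalIntegral.integral_congr fun s _ => ?_
  exacts [(hb _ _).1, (hb _ _).2]

theorem Biperiodic.homSol (hb : Biperiodic b) : Biperiodic (homSol p q b) := by
  intro x y
  simp only [_root_.homSol, (hb.orbitAvg x y).1, (hb.orbitAvg x y).2, add_right_comm x 1,
    add_right_comm y 1]
  constructor <;> congr 2 <;> refine intervalIntegral.integral_congr fun s _ => ?_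
  · simp only [(hb _ _).1]
  · simp only [(hb _ _).2]

/-- In time `q` the orbit advances by the integer vector `(p, q)`. -/
theorem Biperiodic.periodic_orbit (hb : Biperiodic b) (hq : 0 < q) (x y : ℝ) :
    Function.Periodic (fun s : ℝ => b (x + (p : ℝ) / q * s, y + s)) q := by
  intro s
  have hq' : (q : ℝ) ≠ 0 := by positivity
  have h := hb.add_natCast (x + (p : ℝ) / q * s) (y + s) p q
  simp only
  rw [← h]
  congr 2
  · field_simp
    ring
  · ring

theorem orbitAvg_eq_intervalIntegral (hb : Biperiodic b) (hq : 0 < q) (x y t : ℝ) :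
    ∫ s in t..t + q, b (x + (p : ℝ) / q * s, y + s) = q * orbitAvg p q b (x, y) := by
  have hq' : (q : ℝ) ≠ 0 := by positivity
  rw [(hb.periodic_orbit hq x y).intervalIntegral_add_eq t 0, zero_add, _root_.orbitAvg]
  field_simp

/-- Moving the base point only shifts the window of integration, which is a full period. Hence the
average is a function of `x - (p / q) y` alone. -/
theorem orbitAvg_orbit (hb : Biperiodic b) (hq : 0 < q) (x y t : ℝ) :
    orbitAvg p q b (x + (p : ℝ) / q * t, y + t) = orbitAvg p q b (x, y) := by
  have hq' : (q : ℝ) ≠ 0 := by positivity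
  rw [← mul_right_inj' hq', ← orbitAvg_eq_intervalIntegral hb hq x y t, _root_.orbitAvg]
  have := intervalIntegral.integral_comp_add_right
    (fun s => b (x + (p : ℝ) / q * s, y + s)) t (a := 0) (b := q)
  rw [zero_add, add_comm (q : ℝ) t] at this
  rw [← this, ← mul_assoc, mul_one_div_cancel hq', one_mul]
  refine intervalIntegral.integral_congr fun s _ => ?_
  simp only
  congr 2 <;> ring

/-- The substitution moves `t` out of the integrand into the limits and a linear term, so the
derivative along the orbit can be taken without differentiating `b`. -/
theorem homSol_orbit (hb : Biperiodic b) (hc : Continuous b) (hq : 0 < q) (x y t : ℝ) :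
    homSol p q b (x + (p : ℝ) / q * t, y + t) =
      1 / (q : ℝ) * (∫ s in t..t + q, s * b (x + (p : ℝ) / q * s, y + s))
        - (t + (q : ℝ) / 2) * orbitAvg p q b (x, y) := by
  have hq' : (q : ℝ) ≠ 0 := by positivity
  have hcβ : Continuous fun s : ℝ => b (x + (p : ℝ) / q * s, y + s) := by fun_prop
  rw [homSol, orbitAvg_orbit hb hq]
  have h := intervalIntegral.integral_comp_add_right
    (fun s => (s - t) * b (x + (p : ℝ) / q * s, y + s)) t (a := 0) (b := q)
  rw [zero_add, add_comm (q : ℝ) t] at h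
  have h1 : ∫ s in (0 : ℝ)..q, s * b (x + (p : ℝ) / q * t + (p : ℝ) / q * s, y + t + s) =
      ∫ s in t..t + q, (s - t) * b (x + (p : ℝ) / q * s, y + s) := by
    rw [← h]
    refine intervalIntegral.integral_congr fun s _ => ?_
    simp only [add_sub_cancel_right]
    congr 3 <;> ring
  simp only at h1 ⊢
  rw [h1]
  simp only [sub_mul]
  rw [intervalIntegral.integral_sub
    ((by fun_prop : Continuous fun s : ℝ => s * b (x + (p : ℝ) / q * s, y + s)).intervalIntegrable
      _ _)
    ((by fun_prop : Continuous fun s : ℝ => t * b (x + (p : ℝ) / q * s, y + s)).intervalIntegrable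
      _ _), intervalIntegral.integral_const_mul, orbitAvg_eq_intervalIntegral hb hq]
  generalize (∫ s in t..t + (q : ℝ), s * b (x + (p : ℝ) / q * s, y + s)) = J
  field_simp
  ring

/-- The homological equation. -/
theorem hasDerivAt_homSol_orbit (hb : Biperiodic b) (hc : Continuous b) (hq : 0 < q) (x y : ℝ) :
    HasDerivAt (fun t => homSol p q b (x + (p : ℝ) / q * t, y + t))
      (b (x, y) - orbitAvg p q b (x, y)) 0 := by
  have hq' : (q : ℝ) ≠ 0 := by positivity
  have hcβ : Continuous fun s : ℝ => s * b (x + (p : ℝ) / q * s, y + s) := by fun_prop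
  rw [funext fun t => homSol_orbit hb hc hq x y t]
  have hsplit : ∀ t : ℝ, ∫ s in t..t + q, s * b (x + (p : ℝ) / q * s, y + s) =
      (∫ s in (0 : ℝ)..t + q, s * b (x + (p : ℝ) / q * s, y + s)) -
        ∫ s in (0 : ℝ)..t, s * b (x + (p : ℝ) / q * s, y + s) := fun t =>
    (intervalIntegral.integral_interval_sub_left (hcβ.intervalIntegrable _ _)
      (hcβ.intervalIntegrable _ _)).symm
  rw [funext fun t => congrArg (fun r => 1 / (q : ℝ) * r - (t + (q : ℝ) / 2) * orbitAvg p q b (x, y))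
    (hsplit t)]
  have h1 := hcβ.integral_hasStrictDerivAt 0 ((0 : ℝ) + q) |>.hasDerivAt
  have h2 := hcβ.integral_hasStrictDerivAt 0 (0 : ℝ) |>.hasDerivAt
  have h3 := ((h1.comp_add_const 0 (q : ℝ)).sub h2).const_mul (1 / (q : ℝ))
  have h4 := ((hasDerivAt_id (0 : ℝ)).add_const ((q : ℝ) / 2)).mul_const (orbitAvg p q b (x, y))
  -- By periodicity the end-points of the moving window contribute `(1 / q) (q b - 0 b) = b`; the
  -- linear term contributes `-orbitAvg`.
  refine (h3.sub h4).congr_deriv ?_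
  have := hb.periodic_orbit (p := p) hq x y 0
  simp only [zero_add, mul_zero, add_zero] at this ⊢
  rw [this]
  field_simp
  ring

theorem fderiv_homSol (hb : Biperiodic b) (hs : ContDiff ℝ ∞ b) (hq : 0 < q) (z : ℝ × ℝ) :
    fderiv ℝ (homSol p q b) z ((p : ℝ) / q, 1) = b z - orbitAvg p q b z := by
  obtain ⟨x, y⟩ := z
  have h1 := hasDerivAt_homSol_orbit (p := p) hb hs.continuous hq x y
  have h2 : HasFDerivAt (homSol p q b) (fderiv ℝ (homSol p q b) (x, y))
      (x + (p : ℝ) / q * 0, y + 0) := by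
    simpa using ((contDiff_homSol hs).differentiable (by simp) (x, y)).hasFDerivAt
  have h3 : HasDerivAt (fun t : ℝ => (x + (p : ℝ) / q * t, y + t)) ((p : ℝ) / q, 1) 0 := by
    have h4 := ((hasDerivAt_id (0 : ℝ)).const_mul ((p : ℝ) / q)).const_add x
    have h5 := (hasDerivAt_id (0 : ℝ)).const_add y
    simpa using h4.prodMk h5
  have h4 : HasDerivAt (homSol p q b ∘ fun t : ℝ => (x + (p : ℝ) / q * t, y + t))
      (fderiv ℝ (homSol p q b) (x, y) ((p : ℝ) / q, 1)) 0 := HasFDerivAt.comp_hasDerivAt 0 h2 h3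
  exact h4.unique h1

/-- After exchanging the integrals, the inner one is `q * orbitAvg` for every `s`, and the weight
`s` integrates to `q² / 2`. The constant `q / 2` in `homSol` is the one that cancels this. -/
theorem noResonantTerms_homSol (hb : Biperiodic b) (hc : Continuous b) (hq : 0 < q) :
    NoResonantTerms p q (fun x y => homSol p q b (x, y)) := by
  have hq' : (q : ℝ) ≠ 0 := by positivity
  intro x
  have h := fun t => orbitAvg_orbit (p := p) hb hq x 0 t
  simp only [zero_add] at h
  simp only [homSol, h]
  have hcont : Continuous fun w : ℝ × ℝ =>
      w.2 * b (x + (p : ℝ) / q * w.1 + (p : ℝ) / q * w.2, w.1 + w.2) := by fun_prop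
  have hint : Continuous fun t : ℝ => ∫ s in (0 : ℝ)..q,
      s * b (x + (p : ℝ) / q * t + (p : ℝ) / q * s, t + s) :=
    intervalIntegral.continuous_parametric_intervalIntegral_of_continuous' hcont _ _
  have hin : ∀ s : ℝ, ∫ t in (0 : ℝ)..q, s * b (x + (p : ℝ) / q * t + (p : ℝ) / q * s, t + s) =
      s * (q * orbitAvg p q b (x, 0)) := fun s => by
    have h1 := intervalIntegral.integral_comp_add_right
      (fun t => b (x + (p : ℝ) / q * t, 0 + t)) s (a := 0) (b := q)
    rw [zero_add, add_comm (q : ℝ) s, orbitAvg_eq_intervalIntegral hb hq] at h1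
    rw [intervalIntegral.integral_const_mul, ← h1]
    congr 1
    refine intervalIntegral.integral_congr fun t _ => ?_
    congr 2 <;> ring
  rw [intervalIntegral.integral_sub
    ((by fun_prop : Continuous fun t : ℝ => 1 / (q : ℝ) * ∫ s in (0 : ℝ)..q,
      s * b (x + (p : ℝ) / q * t + (p : ℝ) / q * s, t + s)).intervalIntegrable _ _)
    intervalIntegrable_const, intervalIntegral.integral_const_mul,
    MeasureTheory.intervalIntegral_intervalIntegral_swap]
  · rw [intervalIntegral.integral_congr fun s _ => hin s, intervalIntegral.integral_mul_const,
      integral_id, intervalIntegral.integral_const, smul_eq_mul]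
    field_simp
    ring
  · exact (hcont.continuousOn.integrableOn_compact
      (isCompact_uIcc.prod isCompact_uIcc)).mono_set
      (Set.prod_mono Set.uIoc_subset_uIcc Set.uIoc_subset_uIcc)

end OrbitAverage

/-! ### Integral curves of bounded Lipschitz fields -/

theorem IsIntegralCurveOn.hasDerivWithinAt_Ici {E : Type*} [NormedAddCommGroup E]
    [NormedSpace ℝ E] {γ : ℝ → E} {v : ℝ → E → E} {a b : ℝ}
    (h : IsIntegralCurveOn γ v (Set.Icc a b)) {t : ℝ} (ht : t ∈ Set.Ico a b) :
    HasDerivWithinAt γ (v t (γ t)) (Set.Ici t) t :=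
  (h t ⟨ht.1, ht.2.le⟩).mono_of_mem_nhdsWithin (Icc_mem_nhdsGE_of_mem ht)

theorem IsIntegralCurveOn.eqOn_Icc {E : Type*} [NormedAddCommGroup E]
    [NormedSpace ℝ E] {γ δ : ℝ → E} {v : ℝ → E → E} {K : NNReal} (hv : ∀ t, LipschitzWith K (v t))
    {a b : ℝ} (hγ : IsIntegralCurveOn γ v (Set.Icc a b))
    (hδ : IsIntegralCurveOn δ v (Set.Icc a b)) (h : γ a = δ a) :
    Set.EqOn γ δ (Set.Icc a b) :=
  ODE_solution_unique hv hγ.continuousOn (fun _ ht => hγ.hasDerivWithinAt_Ici ht)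
    hδ.continuousOn (fun _ ht => hδ.hasDerivWithinAt_Ici ht) h

theorem exists_isIntegralCurveOn_of_bounded {v : ℝ → ℝ → ℝ} {K L : NNReal}
    (hv : ∀ t, LipschitzWith K (v t)) (hc : ∀ x, Continuous fun t => v t x)
    (hL : ∀ t x, |v t x| ≤ L) {T : ℝ} (hT : 0 ≤ T) (x₀ : ℝ) :
    ∃ γ : ℝ → ℝ, γ 0 = x₀ ∧ IsIntegralCurveOn γ v (Set.Icc 0 T) := by
  -- The bound `L` holds on the whole line, so a solution cannot leave the ball of radius `L T`
  -- before time `T`; existence is not merely local.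
  have h : IsPicardLindelof v (⟨0, le_refl 0, hT⟩ : Set.Icc (0 : ℝ) T) x₀ (L * T.toNNReal) 0 L K :=
    { lipschitzOnWith := fun t _ => (hv t).lipschitzOnWith
      continuousOn := fun x _ => (hc x).continuousOn
      norm_le := fun t _ x _ => hL t x
      mul_max_le := by simp [hT] }
  exact h.exists_eq_forall_mem_Icc_hasDerivWithinAt₀

theorem exists_isFlowMap_of_bounded {V : ℝ → ℝ} {K L : NNReal} (hV : LipschitzWith K V)
    (hL : ∀ x, |V x| ≤ L) {T : ℝ} (hT : 0 ≤ T) : ∃ ψ : ℝ → ℝ, IsFlowMap V T ψ := by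
  choose γ h0 hγ using exists_isIntegralCurveOn_of_bounded (v := fun _ => V) (fun _ => hV)
    (fun _ => continuous_const) (fun _ => hL) hT
  exact ⟨fun x => γ x T, fun z => ⟨γ z, h0 z, hγ z, rfl⟩⟩

/-- The Poincaré map of a bounded Lipschitz field that is periodic in time, and its iterates. -/
theorem exists_isPoincareMap {X : ℝ → ℝ → ℝ} {K L : NNReal}
    (hX : ∀ y, LipschitzWith K fun x => X x y) (hc : ∀ x, Continuous (X x))
    (hL : ∀ x y, |X x y| ≤ L) (hper : ∀ x, Function.Periodic (X x) 1) :
    ∃ F : ℝ → ℝ, IsPoincareMap X F ∧ ∀ (n : ℕ) (x : ℝ), ∃ γ : ℝ → ℝ, γ 0 = x ∧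
      IsIntegralCurveOn γ (fun t x => X x t) (Set.Icc 0 n) ∧ γ n = F^[n] x := by
  -- Solutions are needed from every starting time `y₀`, since a flow map must be defined on the
  -- whole plane.
  choose S hS0 hS using fun y₀ : ℝ => exists_isIntegralCurveOn_of_bounded
    (v := fun t x => X x (y₀ + t)) (fun t => hX (y₀ + t))
    (fun x => (hc x).comp (by fun_prop)) (fun t x => hL x (y₀ + t)) zero_le_one
  refine ⟨fun x => S 0 x 1, ⟨fun z => (S z.2 z.1 1, z.2 + 1), fun z => ?_, fun x => by simp⟩, ?_⟩
  · refine ⟨fun t => (S z.2 z.1 t, z.2 + t), by simp [hS0], fun t ht => ?_, rfl⟩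
    exact (hS z.2 z.1 t ht).prodMk ((hasDerivAt_id t).const_add z.2).hasDerivWithinAt
  intro n x
  obtain ⟨γ, h0, hγ⟩ := exists_isIntegralCurveOn_of_bounded
    (v := fun t x => X x t) hX hc (fun t x => hL x t) (Nat.cast_nonneg n) x
  -- By periodicity, the long solution restarted at an integer time solves the original equation, so
  -- uniqueness makes each unit of time one application of the Poincaré map.
  have key : ∀ j : ℕ, j ≤ n → γ j = (fun x => S 0 x 1)^[j] x := by
    intro j
    induction j with
    | zero => simp [h0]
    | succ j ih =>
      intro hj
      rw [Function.iterate_succ_apply', ← ih (by omega)]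
      have hj' : (j : ℝ) + 1 ≤ n := by exact_mod_cast hj
      have h1 : IsIntegralCurveOn (fun t => γ (t + j)) (fun t x => X x (0 + t))
          (Set.Icc 0 1) := by
        intro t ht
        have h2 := hγ (t + j) ⟨by have := ht.1; positivity, by linarith [ht.2]⟩
        have h3 : X (γ (t + j)) (t + j) = X (γ (t + j)) (0 + t) := by
          have := (hper (γ (t + j))).nat_mul j t
          simpa using this
        simp only at h2
        rw [h3] at h2
        have h4 := h2.scomp t ((hasDerivAt_id t).add_const (j : ℝ)).hasDerivWithinAt
          (s := Set.Icc 0 1) (fun s hs => by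
            constructor
            · have := hs.1
              simp only [id]
              positivity
            · simp only [id]
              linarith [hs.2])
        simpa [Function.comp_def] using h4
      have h5 := h1.eqOn_Icc (fun t => hX (0 + t)) (hS 0 (γ j)) (by simp [hS0])
        (Set.right_mem_Icc.2 zero_le_one)
      simp only at h5
      rw [← h5]
      push_cast
      ring_nf
  exact ⟨γ, h0, hγ, key n le_rfl⟩

/-! ### Comparison of the Poincaré map with the averaged flow. -/

theorem fderiv_prod_apply {a : ℝ × ℝ → ℝ} (ha : Differentiable ℝ a) (x y u v : ℝ) :
    fderiv ℝ a (x, y) (u, v) =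
      u * deriv (fun x' => a (x', y)) x + v * deriv (fun y' => a (x, y')) y := by
  have h1 : HasDerivAt (fun x' => a (x', y)) (fderiv ℝ a (x, y) (1, 0)) x :=
    (ha (x, y)).hasFDerivAt.comp_hasDerivAt x ((hasDerivAt_id x).prodMk (hasDerivAt_const x y))
  have h2 : HasDerivAt (fun y' => a (x, y')) (fderiv ℝ a (x, y) (0, 1)) y :=
    (ha (x, y)).hasFDerivAt.comp_hasDerivAt y ((hasDerivAt_const y x).prodMk (hasDerivAt_id y))
  rw [h1.deriv, h2.deriv, ← smul_eq_mul, ← smul_eq_mul, ← map_smul, ← map_smul, ← map_add]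
  simp

/-- With no initial gap the bound is linear in the error, so a cubic error in the field stays cubic
after time `q`. -/
theorem gronwallBound_zero_mul (K ε x : ℝ) :
    gronwallBound 0 K ε x = ε * gronwallBound 0 K 1 x := by
  by_cases hK : K = 0
  · simp [hK, gronwallBound_K0]
  · simp [gronwallBound_of_K_ne_0 hK]
    ring

/-- A change of coordinates that takes `x' = X x y`, `y' = 1` to `ξ' = p / q + Z (ξ - (p / q) y)` up
to an error `e` takes the `q`-th iterate of the Poincaré map to the time-`q` map of `Z`, up to a
multiple of `e`. -/
theorem iterate_poincareMap_sub_flow_le {p q : ℕ} (hq : 0 < q) {X : ℝ → ℝ → ℝ} {F : ℝ → ℝ}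
    (hF : ∀ (n : ℕ) (x : ℝ), ∃ γ : ℝ → ℝ, γ 0 = x ∧
      IsIntegralCurveOn γ (fun t x => X x t) (Set.Icc 0 n) ∧ γ n = F^[n] x)
    {a : ℝ × ℝ → ℝ} (ha : Differentiable ℝ a) (hper : Biperiodic a)
    {Z : ℝ → ℝ} {K : NNReal} (hZ : LipschitzWith K Z) {ψ : ℝ → ℝ} (hψ : IsFlowMap Z q ψ) {e : ℝ}
    (he : ∀ x y, |X x y * (1 + deriv (fun x' => a (x', y)) x) + deriv (fun y' => a (x, y')) y
      - ((p : ℝ) / q + Z (x + a (x, y) - (p : ℝ) / q * y))| ≤ e) (x : ℝ) :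
    |(F^[q] x + a (F^[q] x, 0) - p) - ψ (x + a (x, 0))| ≤ e * gronwallBound 0 K 1 q := by
  have hq' : (q : ℝ) ≠ 0 := by positivity
  obtain ⟨γ, h0, hγ, hγq⟩ := hF q x
  obtain ⟨δ, hδ0, hδ, hδq⟩ := hψ (x + a (x, 0))
  -- This is `u = ξ - (p / q) y` along the solution; its velocity is within `e` of `Z u`, and it
  -- starts where `δ` does.
  have hu : ∀ t ∈ Set.Icc (0 : ℝ) q, HasDerivWithinAt
      (fun t => γ t + a (γ t, t) - (p : ℝ) / q * t)
      (X (γ t) t * (1 + deriv (fun x' => a (x', t)) (γ t)) + deriv (fun y' => a (γ t, y')) t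
        - (p : ℝ) / q) (Set.Icc 0 q) t := by
    intro t ht
    have h1 := hγ t ht
    have h2 : HasDerivWithinAt (fun t => a (γ t, t)) (fderiv ℝ a (γ t, t) (X (γ t) t, 1))
        (Set.Icc 0 q) t :=
      HasFDerivAt.comp_hasDerivWithinAt (f := fun t => (γ t, t)) t (ha (γ t, t)).hasFDerivAt
        (h1.prodMk (hasDerivAt_id t).hasDerivWithinAt)
    have h3 := ((hasDerivAt_id t).const_mul ((p : ℝ) / q)).hasDerivWithinAt (s := Set.Icc 0 (q : ℝ))
    refine ((h1.add h2).sub h3).congr_deriv ?_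
    rw [fderiv_prod_apply ha]
    ring
  have hd := dist_le_of_approx_trajectories_ODE (v := fun _ => Z) (fun _ => hZ)
    (f := fun t => γ t + a (γ t, t) - (p : ℝ) / q * t) (g := δ) (a := 0) (b := q) (εf := e)
    (εg := 0) (δ := 0)
    (fun t ht => (hu t ht).continuousWithinAt)
    (fun t ht => (hu t ⟨ht.1, ht.2.le⟩).mono_of_mem_nhdsWithin (Icc_mem_nhdsGE_of_mem ht))
    (fun t ht => by
      rw [Real.dist_eq]
      convert! he (γ t) t using 2
      ring)
    hδ.continuousOn (fun t ht => hδ.hasDerivWithinAt_Ici ht) (fun t ht => by simp)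
    (by simp [h0, hδ0]) q (Set.right_mem_Icc.2 (Nat.cast_nonneg q))
  -- At time `q` the coordinate change is the one at `y = 0`, and `(p / q) t` has become `p`.
  have hqp : a (F^[q] x, (q : ℝ)) = a (F^[q] x, 0) := by
    simpa using hper.add_natCast (F^[q] x) 0 0 q
  rw [gronwallBound_zero_mul, add_zero, sub_zero, Real.dist_eq] at hd
  simpa only [hγq, hδq, hqp, div_mul_cancel₀ _ hq'] using hd

/-! ### Bounds for periodic functions -/

theorem Function.Periodic.exists_abs_le {h : ℝ → ℝ} (hh : Function.Periodic h 1)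
    (hc : Continuous h) : ∃ C, ∀ x, |h x| ≤ C := by
  obtain ⟨C, hC⟩ := isCompact_Icc.exists_bound_of_continuousOn (s := Set.Icc (0 : ℝ) 1)
    hc.continuousOn
  refine ⟨C, fun x => ?_⟩
  obtain ⟨y, hy, hxy⟩ := hh.exists_mem_Ico₀ one_pos x
  rw [hxy]
  exact hC y (Set.Ico_subset_Icc_self hy)

theorem Biperiodic.exists_abs_le {b : ℝ × ℝ → ℝ} (hb : Biperiodic b)
    (hc : Continuous b) : ∃ C, ∀ z, |b z| ≤ C := by
  obtain ⟨C, hC⟩ := (isCompact_Icc.prod isCompact_Icc).exists_bound_of_continuousOn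
    (s := Set.Icc (0 : ℝ) 1 ×ˢ Set.Icc (0 : ℝ) 1) hc.continuousOn
  refine ⟨C, fun z => ?_⟩
  obtain ⟨x, y⟩ := z
  obtain ⟨x', hx, hxx⟩ := Function.Periodic.exists_mem_Ico₀ (f := fun x => b (x, y)) (c := 1)
    (fun x => (hb x y).1) one_pos x
  obtain ⟨y', hy, hyy⟩ := Function.Periodic.exists_mem_Ico₀ (f := fun y => b (x', y)) (c := 1)
    (fun y => (hb x' y).2) one_pos y
  rw [hxx, hyy]
  exact hC (x', y') ⟨Set.Ico_subset_Icc_self hx, Set.Ico_subset_Icc_self hy⟩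

theorem Function.Periodic.exists_lipschitzWith {h : ℝ → ℝ} (hh : Function.Periodic h 1)
    (hc : ContDiff ℝ ∞ h) : ∃ C : NNReal, LipschitzWith C h := by
  have hp : Function.Periodic (deriv h) 1 := fun x => by
    rw [← deriv_comp_add_const, funext hh]
  obtain ⟨C, hC⟩ := hp.exists_abs_le (hc.continuous_deriv (by simp))
  refine ⟨C.toNNReal, lipschitzWith_of_nnnorm_deriv_le (hc.differentiable (by simp)) fun x => ?_⟩
  rw [← NNReal.coe_le_coe, coe_nnnorm]
  exact (hC x).trans (Real.le_coe_toNNReal C)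

theorem Biperiodic.exists_abs_deriv_fst_le {b : ℝ × ℝ → ℝ} (hb : Biperiodic b)
    (hc : ContDiff ℝ ∞ b) : ∃ C, ∀ x y, |deriv (fun x' => b (x', y)) x| ≤ C := by
  have hd : Differentiable ℝ b := hc.differentiable (by simp)
  have h1 : Continuous fun z => fderiv ℝ b z (1, 0) :=
    (hc.continuous_fderiv (by simp)).clm_apply continuous_const
  have h2 : Biperiodic fun z => fderiv ℝ b z (1, 0) := by
    intro x y
    have e1 : (fun z : ℝ × ℝ => b (z + (1, 0))) = b := funext fun z => by
      obtain ⟨x, y⟩ := z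
      simpa using (hb x y).1
    have e2 : (fun z : ℝ × ℝ => b (z + (0, 1))) = b := funext fun z => by
      obtain ⟨x, y⟩ := z
      simpa using (hb x y).2
    have d1 := fderiv_comp_add_right (𝕜 := ℝ) (f := b) (x := (x, y)) (1, 0)
    have d2 := fderiv_comp_add_right (𝕜 := ℝ) (f := b) (x := (x, y)) (0, 1)
    rw [e1] at d1
    rw [e2] at d2
    simp only [Prod.mk_add_mk, add_zero] at d1 d2
    exact ⟨by simp only [d1], by simp only [d2]⟩
  obtain ⟨C, hC⟩ := h2.exists_abs_le h1
  refine ⟨C, fun x y => ?_⟩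
  have h3 := hC (x, y)
  simpa [fderiv_prod_apply hd] using h3

/-! ### Averages over the orbits of functions of one variable -/

/-- Along one closed orbit `x` runs through exactly `p` periods. -/
theorem orbitAvg_comp_fst {p q : ℕ} (hp : 0 < p) (hq : 0 < q) {h : ℝ → ℝ}
    (hh : Function.Periodic h 1) (hc : Continuous h) (z : ℝ × ℝ) :
    orbitAvg p q (fun z => h z.1) z = ∫ t in (0 : ℝ)..1, h t := by
  have hp' : (p : ℝ) ≠ 0 := by positivity
  have hq' : (q : ℝ) ≠ 0 := by positivity
  have h1 := hh.intervalIntegral_add_zsmul_eq p z.1 fun _ _ => hc.intervalIntegrable _ _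
  rw [hh.intervalIntegral_add_eq z.1 0, zero_add] at h1
  simp only [orbitAvg]
  rw [intervalIntegral.integral_comp_add_mul _ (div_ne_zero hp' hq'), mul_zero, add_zero,
    div_mul_cancel₀ _ hq']
  simp only [zsmul_eq_mul, Int.cast_natCast, mul_one] at h1
  rw [h1, smul_eq_mul]
  field_simp

theorem orbitAvg_comp_snd {p q : ℕ} (hq : 0 < q) {h : ℝ → ℝ}
    (hh : Function.Periodic h 1) (hc : Continuous h) (z : ℝ × ℝ) :
    orbitAvg p q (fun z => h z.2) z = ∫ t in (0 : ℝ)..1, h t := by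
  have hq' : (q : ℝ) ≠ 0 := by positivity
  have h1 := hh.intervalIntegral_add_zsmul_eq q z.2 fun _ _ => hc.intervalIntegrable _ _
  rw [hh.intervalIntegral_add_eq z.2 0, zero_add] at h1
  simp only [orbitAvg]
  rw [intervalIntegral.integral_comp_add_left, add_zero]
  simp only [zsmul_eq_mul, Int.cast_natCast, mul_one] at h1
  rw [h1]
  field_simp

/-- The resonant part of a biperiodic function has period `1 / q` in `u = x - (p / q) y`. -/
theorem orbitAvg_periodic {p q : ℕ} (hp : 0 < p) (hq : 0 < q) (hpq : Nat.Coprime p q) {b : ℝ × ℝ → ℝ}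
    (hb : Biperiodic b) : Function.Periodic (fun u => orbitAvg p q b (u, 0)) (1 / (q : ℝ)) := by
  have hq' : (q : ℝ) ≠ 0 := by positivity
  intro u
  -- With `p j = 1 + q m`, following the orbit for time `j` takes `(u, 0)` to `(u + 1 / q + m, j)`,
  -- which is `(u + 1 / q, 0)` on the torus.
  obtain ⟨j, m, h⟩ : ∃ j m : ℕ, p * j = 1 + q * m := by
    rcases Nat.lt_or_ge 1 q with h1 | h1
    · obtain ⟨j, hj⟩ := Nat.exists_mul_mod_eq_one_of_coprime hpq h1
      exact ⟨j, p * j / q, by have := Nat.mod_add_div (p * j) q; omega⟩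
    · obtain rfl : q = 1 := by omega
      exact ⟨1, p - 1, by omega⟩
  have h1 := orbitAvg_orbit (p := p) hb hq u 0 j
  simp only
  rw [← h1, ← hb.orbitAvg.add_natCast _ 0 m j]
  congr 2
  have h' : (p : ℝ) * j = 1 + q * m := by exact_mod_cast h
  rw [div_mul_eq_mul_div, h']
  field_simp
  ring

/-! ### The averaging theorem -/

theorem abs_le_paramSize (P : ℝ × ℝ × ℝ) :
    |P.1| ≤ paramSize P ^ 2 ∧ |P.2.1| ≤ paramSize P ∧ |P.2.2| ≤ paramSize P := by
  have h1 := abs_nonneg P.2.1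
  have h2 := abs_nonneg P.2.2
  have h3 := Real.sqrt_nonneg |P.1|
  have h4 := Real.sq_sqrt (abs_nonneg P.1)
  refine ⟨?_, ?_, ?_⟩
  · rw [← h4]
    unfold paramSize
    gcongr
    linarith
  · unfold paramSize
    linarith
  · unfold paramSize
    linarith

/-- The terms of degree at least three that are left after two steps of averaging. -/
theorem abs_averaging_remainder_le {B ρ k σ η ε fx gy ax hx a R₁ R₂ : ℝ} (hB : 1 ≤ B)
    (hρ0 : 0 ≤ ρ) (hσ : |σ| ≤ ρ ^ 2) (hη : |η| ≤ ρ) (hε : |ε| ≤ ρ) (hk : |k| ≤ B)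
    (hf : |fx| ≤ B) (hg : |gy| ≤ B) (hax : |ax| ≤ 3 * B ^ 2 * ρ) (hhx : |hx| ≤ 2 * B ^ 2 * ρ ^ 2)
    (ha : |a| ≤ 4 * B ^ 2 * ρ) (hR : |R₁ - R₂| ≤ B * |a|) :
    |σ * ax + (η * fx + ε * gy) * hx + k * ε * η * (R₁ - R₂)| ≤ 11 * B ^ 4 * ρ ^ 3 := by
  -- Here `ax` is the full `x`-derivative of the coordinate change, `hx` its quadratic part, and `R₁
  -- - R₂` the effect of evaluating the resonant term at `ξ` instead of `x`. The constant is `11 = 3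
  -- + 4 + 4`.
  have h1 : |σ * ax| ≤ ρ ^ 2 * (3 * B ^ 2 * ρ) := by rw [abs_mul]; gcongr
  have h2 : |η * fx + ε * gy| ≤ ρ * B + ρ * B := by
    refine (abs_add_le _ _).trans ?_
    rw [abs_mul, abs_mul]
    gcongr
  have h3 : |(η * fx + ε * gy) * hx| ≤ (ρ * B + ρ * B) * (2 * B ^ 2 * ρ ^ 2) := by
    rw [abs_mul]; gcongr
  have h4 : |R₁ - R₂| ≤ B * (4 * B ^ 2 * ρ) := hR.trans (by gcongr)
  have h5 : |k * ε * η * (R₁ - R₂)| ≤ B * ρ * ρ * (B * (4 * B ^ 2 * ρ)) := by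
    rw [abs_mul, abs_mul, abs_mul]; gcongr
  have h6 : B ^ 2 ≤ B ^ 4 := pow_le_pow_right₀ hB (by norm_num)
  have h7 : B ^ 3 ≤ B ^ 4 := pow_le_pow_right₀ hB (by norm_num)
  have h8 : 0 ≤ ρ ^ 3 := by positivity
  calc _ ≤ |σ * ax| + |(η * fx + ε * gy) * hx| + |k * ε * η * (R₁ - R₂)| := abs_add_three _ _ _
    _ ≤ ρ ^ 2 * (3 * B ^ 2 * ρ) + (ρ * B + ρ * B) * (2 * B ^ 2 * ρ ^ 2) +
        B * ρ * ρ * (B * (4 * B ^ 2 * ρ)) := by gcongr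
    _ = (3 * B ^ 2 + 4 * B ^ 3 + 4 * B ^ 4) * ρ ^ 3 := by ring
    _ ≤ 11 * B ^ 4 * ρ ^ 3 := by
      gcongr
      linarith

/-- The terms of degree two produced by averaging `x' = p / q + σ + η f x + ε g y`, `y' = 1`. -/
noncomputable def averagedTerm (p q : ℕ) (f g : ℝ → ℝ) (η ε u : ℝ) : ℝ :=
  -((q : ℝ) / p) * (η ^ 2 * (∫ t in (0 : ℝ)..1, f t * (f t - ∫ t in (0 : ℝ)..1, f t))
    + ε * η * orbitAvg p q (fun z => g z.2 * (f z.1 - ∫ t in (0 : ℝ)..1, f t)) (u, 0))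

theorem biperiodic_comp_fst {h : ℝ → ℝ} (hh : Function.Periodic h 1) :
    Biperiodic fun z => h z.1 := fun x _ => ⟨hh x, rfl⟩

theorem biperiodic_comp_snd {h : ℝ → ℝ} (hh : Function.Periodic h 1) :
    Biperiodic fun z => h z.2 := fun _ y => ⟨rfl, hh y⟩

theorem deriv_homSol {p q : ℕ} (hq : 0 < q) {b : ℝ × ℝ → ℝ} (hb : Biperiodic b)
    (hs : ContDiff ℝ ∞ b) (x y : ℝ) :
    (p : ℝ) / q * deriv (fun x' => homSol p q b (x', y)) x
      + deriv (fun y' => homSol p q b (x, y')) y = b (x, y) - orbitAvg p q b (x, y) := by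
  rw [← fderiv_homSol hb hs hq, fderiv_prod_apply ((contDiff_homSol hs).differentiable (by simp)),
    one_mul]

theorem orbitAvg_eq_orbitAvg_zero {p q : ℕ} (hq : 0 < q) {b : ℝ × ℝ → ℝ} (hb : Biperiodic b)
    (x y : ℝ) : orbitAvg p q b (x, y) = orbitAvg p q b (x - (p : ℝ) / q * y, 0) := by
  rw [← orbitAvg_orbit hb hq _ 0 y]
  simp

/-- The solution does not depend on `y`, so the homological equation is an ordinary one. This is the
origin of the factor `q / p` in the averaged field. -/
theorem deriv_homSol_comp_fst {p q : ℕ} (hp : 0 < p) (hq : 0 < q) {h : ℝ → ℝ}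
    (hh : Function.Periodic h 1) (hs : ContDiff ℝ ∞ h) (x y : ℝ) :
    deriv (fun x' => homSol p q (fun z => h z.1) (x', y)) x =
      (q : ℝ) / p * (h x - ∫ t in (0 : ℝ)..1, h t) := by
  have hp' : (p : ℝ) ≠ 0 := by positivity
  have hq' : (q : ℝ) ≠ 0 := by positivity
  have h1 := deriv_homSol (p := p) hq (biperiodic_comp_fst hh) (hs.comp contDiff_fst) x y
  have h2 : (fun y' => homSol p q (fun z => h z.1) (x, y')) =
      fun _ => homSol p q (fun z => h z.1) (x, y) := by
    funext y'
    simp only [homSol, orbitAvg]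
  rw [h2, deriv_const, add_zero, orbitAvg_comp_fst hp hq hh hs.continuous] at h1
  rw [← h1]
  field_simp

theorem deriv_homSol_comp_snd {p q : ℕ} {h : ℝ → ℝ} (x y : ℝ) :
    deriv (fun x' => homSol p q (fun z => h z.2) (x', y)) x = 0 := by
  have h2 : (fun x' => homSol p q (fun z => h z.2) (x', y)) =
      fun _ => homSol p q (fun z => h z.2) (x, y) := by
    funext y'
    simp only [homSol, orbitAvg]
  rw [h2, deriv_const]

theorem averagedTerm_periodic {p q : ℕ} (hp : 0 < p) (hq : 0 < q) (hpq : Nat.Coprime p q)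
    {f g : ℝ → ℝ} (hf : Function.Periodic f 1) (hg : Function.Periodic g 1) (η ε : ℝ) :
    Function.Periodic (averagedTerm p q f g η ε) (1 / (q : ℝ)) := by
  intro u
  have hb : Biperiodic fun z => g z.2 * (f z.1 - ∫ t in (0 : ℝ)..1, f t) :=
    fun x y => ⟨by simp only [hf x], by simp only [hg y]⟩
  have := orbitAvg_periodic hp hq hpq hb u
  simp only at this
  rw [averagedTerm, averagedTerm, this]

set_option maxHeartbeats 1000000 in
/-- Second-order averaging of `x' = p / q + σ + η f x + ε g y`, `y' = 1`. -/
theorem isVectorFieldApprox_averagedTerm {p q : ℕ} (hp : 0 < p) (hq : 0 < q)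
    (hpq : Nat.Coprime p q) {f g : ℝ → ℝ} (hf : ContDiff ℝ ∞ f) (hfp : Function.Periodic f 1)
    (hg : ContDiff ℝ ∞ g) (hgp : Function.Periodic g 1) :
    IsVectorFieldApprox p q
      (fun P x y => (p : ℝ) / q + P.1 + P.2.1 * f x + P.2.2 * g y)
      (fun P u => P.1 + P.2.1 * (∫ t in (0 : ℝ)..1, f t) + P.2.2 * (∫ t in (0 : ℝ)..1, g t)
        + averagedTerm p q f g P.2.1 P.2.2 u) := by
  have hp' : (p : ℝ) ≠ 0 := by positivity
  have hq' : (q : ℝ) ≠ 0 := by positivity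
  have hWp := averagedTerm_periodic hp hq hpq hfp hgp
  unfold averagedTerm at hWp ⊢
  set f₀ := ∫ t in (0 : ℝ)..1, f t with hf₀
  set g₀ := ∫ t in (0 : ℝ)..1, g t with hg₀
  set M := ∫ t in (0 : ℝ)..1, f t * (f t - f₀) with hM
  set b₁ : ℝ × ℝ → ℝ := fun z => f z.1 with hb₁
  set b₂ : ℝ × ℝ → ℝ := fun z => g z.2 with hb₂
  set b₃ : ℝ × ℝ → ℝ := fun z => f z.1 * (f z.1 - f₀) with hb₃
  set b₄ : ℝ × ℝ → ℝ := fun z => g z.2 * (f z.1 - f₀) with hb₄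
  have hffp : Function.Periodic (fun x => f x * (f x - f₀)) 1 := fun x => by simp only [hfp x]
  have hffs : ContDiff ℝ ∞ (fun x => f x * (f x - f₀)) := hf.mul (hf.sub contDiff_const)
  have per₁ : Biperiodic b₁ := biperiodic_comp_fst hfp
  have per₂ : Biperiodic b₂ := biperiodic_comp_snd hgp
  have per₃ : Biperiodic b₃ := biperiodic_comp_fst hffp
  have per₄ : Biperiodic b₄ := fun x y => ⟨by simp only [hb₄, hfp x], by simp only [hb₄, hgp y]⟩
  have sm₁ : ContDiff ℝ ∞ b₁ := hf.comp contDiff_fst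
  have sm₂ : ContDiff ℝ ∞ b₂ := hg.comp contDiff_snd
  have sm₃ : ContDiff ℝ ∞ b₃ := hffs.comp contDiff_fst
  have sm₄ : ContDiff ℝ ∞ b₄ := sm₂.mul (sm₁.sub contDiff_const)
  set R : ℝ → ℝ := fun u => orbitAvg p q b₄ (u, 0) with hR
  have hRs : ContDiff ℝ ∞ R := (contDiff_orbitAvg sm₄).comp (contDiff_id.prodMk contDiff_const)
  have hRp : Function.Periodic R 1 := fun u => (per₄.orbitAvg u 0).1
  set H₁ := homSol p q b₁ with hH₁
  set H₂ := homSol p q b₂ with hH₂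
  set H₃ := homSol p q b₃ with hH₃
  set H₄ := homSol p q b₄ with hH₄
  have hs₁ : ContDiff ℝ ∞ H₁ := contDiff_homSol sm₁
  have hs₂ : ContDiff ℝ ∞ H₂ := contDiff_homSol sm₂
  have hs₃ : ContDiff ℝ ∞ H₃ := contDiff_homSol sm₃
  have hs₄ : ContDiff ℝ ∞ H₄ := contDiff_homSol sm₄
  have hp₁ : Biperiodic H₁ := per₁.homSol
  have hp₂ : Biperiodic H₂ := per₂.homSol
  have hp₃ : Biperiodic H₃ := per₃.homSol
  have hp₄ : Biperiodic H₄ := per₄.homSol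
  set k : ℝ := (q : ℝ) / p with hk
  -- constants
  obtain ⟨B, hB, hBk, hBf, hBf', hBg, hB₁, hB₂, hB₃, hB₄, hB₃', hB₄', hBfL, hBR⟩ : ∃ B : NNReal,
      1 ≤ (B : ℝ) ∧ |k| ≤ B ∧ (∀ x, |f x| ≤ B) ∧ (∀ x, |f x - f₀| ≤ B) ∧ (∀ x, |g x| ≤ B) ∧
      (∀ z, |H₁ z| ≤ B) ∧ (∀ z, |H₂ z| ≤ B) ∧ (∀ z, |H₃ z| ≤ B) ∧ (∀ z, |H₄ z| ≤ B) ∧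
      (∀ x y, |deriv (fun x' => H₃ (x', y)) x| ≤ B) ∧
      (∀ x y, |deriv (fun x' => H₄ (x', y)) x| ≤ B) ∧ LipschitzWith B f ∧ LipschitzWith B R := by
    obtain ⟨c₁, h₁⟩ := hfp.exists_abs_le hf.continuous
    obtain ⟨c₂, h₂⟩ := hgp.exists_abs_le hg.continuous
    obtain ⟨c₃, h₃⟩ := hp₁.exists_abs_le hs₁.continuous
    obtain ⟨c₄, h₄⟩ := hp₂.exists_abs_le hs₂.continuous
    obtain ⟨c₅, h₅⟩ := hp₃.exists_abs_le hs₃.continuous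
    obtain ⟨c₆, h₆⟩ := hp₄.exists_abs_le hs₄.continuous
    obtain ⟨c₇, h₇⟩ := hp₃.exists_abs_deriv_fst_le hs₃
    obtain ⟨c₈, h₈⟩ := hp₄.exists_abs_deriv_fst_le hs₄
    obtain ⟨c₉, h₉⟩ := hfp.exists_lipschitzWith hf
    obtain ⟨c₀, h₀⟩ := hRp.exists_lipschitzWith hRs
    have q₁ := (abs_nonneg _).trans (h₁ 0)
    have q₂ := (abs_nonneg _).trans (h₂ 0)
    have q₃ := (abs_nonneg _).trans (h₃ 0)
    have q₄ := (abs_nonneg _).trans (h₄ 0)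
    have q₅ := (abs_nonneg _).trans (h₅ 0)
    have q₆ := (abs_nonneg _).trans (h₆ 0)
    have q₇ := (abs_nonneg _).trans (h₇ 0 0)
    have q₈ := (abs_nonneg _).trans (h₈ 0 0)
    have q₉ : 0 ≤ (c₉ : ℝ) := c₉.2
    have q₀ : 0 ≤ (c₀ : ℝ) := c₀.2
    have qk := abs_nonneg k
    have qf := abs_nonneg f₀
    have hsum : 0 ≤ 1 + |k| + |f₀| + c₁ + c₂ + c₃ + c₄ + c₅ + c₆ + c₇ + c₈ + c₉ + c₀ := by
      positivity
    obtain ⟨B, hBS⟩ : ∃ B : NNReal,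
        (B : ℝ) = 1 + |k| + |f₀| + c₁ + c₂ + c₃ + c₄ + c₅ + c₆ + c₇ + c₈ + c₉ + c₀ :=
      ⟨_, Real.coe_toNNReal _ hsum⟩
    refine ⟨B, ?_, ?_, ?_, ?_, ?_, ?_, ?_, ?_, ?_, ?_, ?_, ?_, ?_⟩
    · linarith
    · linarith
    · exact fun x => (h₁ x).trans (by linarith)
    · exact fun x => (abs_sub _ _).trans (by linarith [h₁ x])
    · exact fun x => (h₂ x).trans (by linarith)
    · exact fun x => (h₃ x).trans (by linarith)
    · exact fun x => (h₄ x).trans (by linarith)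
    · exact fun x => (h₅ x).trans (by linarith)
    · exact fun x => (h₆ x).trans (by linarith)
    · exact fun x y => (h₇ x y).trans (by linarith)
    · exact fun x y => (h₈ x y).trans (by linarith)
    · exact h₉.weaken (NNReal.coe_le_coe.1 (by linarith))
    · exact h₀.weaken (NNReal.coe_le_coe.1 (by linarith))
  have hB0 : (0 : ℝ) ≤ B := B.2
  -- The linear part removes the oscillation of `η f + ε g`. The quadratic part removes that of its
  -- product with `-η k (f - f₀)`, the linear part of the `x`-derivative.
  set a : ℝ × ℝ × ℝ → ℝ → ℝ → ℝ := fun P x y => -(P.2.1 * H₁ (x, y)) - P.2.2 * H₂ (x, y)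
    + k * (P.2.1 ^ 2 * H₃ (x, y) + P.2.2 * P.2.1 * H₄ (x, y)) with ha
  have haS : ContDiff ℝ ∞ fun w : (ℝ × ℝ × ℝ) × ℝ × ℝ => a w.1 w.2.1 w.2.2 := by
    simp only [ha]
    fun_prop
  have haP : ∀ P, Biperiodic fun z : ℝ × ℝ => a P z.1 z.2 := fun P x y => by
    simp only [ha, (hp₁ x y).1, (hp₁ x y).2, (hp₂ x y).1, (hp₂ x y).2, (hp₃ x y).1, (hp₃ x y).2,
      (hp₄ x y).1, (hp₄ x y).2, and_self]
  have haD : ∀ P, Differentiable ℝ fun z : ℝ × ℝ => a P z.1 z.2 := fun P =>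
    (haS.comp (contDiff_const.prodMk contDiff_id)).differentiable (by simp)
  have dfst : ∀ {H : ℝ × ℝ → ℝ}, ContDiff ℝ ∞ H → ∀ x y,
      DifferentiableAt ℝ (fun x' => H (x', y)) x := fun hH x y =>
    (hH.comp (contDiff_id.prodMk contDiff_const)).differentiable (by simp) x
  have dsnd : ∀ {H : ℝ × ℝ → ℝ}, ContDiff ℝ ∞ H → ∀ x y,
      DifferentiableAt ℝ (fun y' => H (x, y')) y := fun hH x y =>
    (hH.comp (contDiff_const.prodMk contDiff_id)).differentiable (by simp) y
  have hax : ∀ P x y, deriv (fun x' => a P x' y) x = -(P.2.1 * (k * (f x - f₀)))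
      + k * (P.2.1 ^ 2 * deriv (fun x' => H₃ (x', y)) x
        + P.2.2 * P.2.1 * deriv (fun x' => H₄ (x', y)) x) := fun P x y => by
    have h := ((((dfst hs₁ x y).hasDerivAt.const_mul P.2.1).neg).sub
      ((dfst hs₂ x y).hasDerivAt.const_mul P.2.2)).add
      ((((dfst hs₃ x y).hasDerivAt.const_mul (P.2.1 ^ 2)).add
        ((dfst hs₄ x y).hasDerivAt.const_mul (P.2.2 * P.2.1))).const_mul k)
    refine h.deriv.trans ?_
    rw [hH₁, hH₂, deriv_homSol_comp_fst hp hq hfp hf, deriv_homSol_comp_snd]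
    ring
  -- The derivative of `a` along the unperturbed field, given by the four homological equations.
  have hay : ∀ P x y, (p : ℝ) / q * deriv (fun x' => a P x' y) x + deriv (fun y' => a P x y') y =
      -(P.2.1 * (f x - f₀)) - P.2.2 * (g y - g₀)
      + k * (P.2.1 ^ 2 * (f x * (f x - f₀) - M)
        + P.2.2 * P.2.1 * (g y * (f x - f₀) - R (x - (p : ℝ) / q * y))) := fun P x y => by
    have h := ((((dfst hs₁ x y).hasDerivAt.const_mul P.2.1).neg).sub
      ((dfst hs₂ x y).hasDerivAt.const_mul P.2.2)).add
      ((((dfst hs₃ x y).hasDerivAt.const_mul (P.2.1 ^ 2)).add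
        ((dfst hs₄ x y).hasDerivAt.const_mul (P.2.2 * P.2.1))).const_mul k)
    have h' := ((((dsnd hs₁ x y).hasDerivAt.const_mul P.2.1).neg).sub
      ((dsnd hs₂ x y).hasDerivAt.const_mul P.2.2)).add
      ((((dsnd hs₃ x y).hasDerivAt.const_mul (P.2.1 ^ 2)).add
        ((dsnd hs₄ x y).hasDerivAt.const_mul (P.2.2 * P.2.1))).const_mul k)
    have e₁ := deriv_homSol (p := p) hq per₁ sm₁ x y
    have e₂ := deriv_homSol (p := p) hq per₂ sm₂ x y
    have e₃ := deriv_homSol (p := p) hq per₃ sm₃ x y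
    have e₄ := deriv_homSol (p := p) hq per₄ sm₄ x y
    rw [orbitAvg_comp_fst hp hq hfp hf.continuous] at e₁
    rw [orbitAvg_comp_snd hq hgp hg.continuous] at e₂
    rw [orbitAvg_comp_fst hp hq hffp hffs.continuous] at e₃
    rw [orbitAvg_eq_orbitAvg_zero hq per₄] at e₄
    refine (congrArg₂ (fun r s => (p : ℝ) / q * r + s) h.deriv h'.deriv).trans ?_
    linear_combination (-P.2.1) * e₁ - P.2.2 * e₂ + k * P.2.1 ^ 2 * e₃ + k * P.2.2 * P.2.1 * e₄
  refine ⟨fun P u => ?_, a, haS, fun P x y => haP P x y, fun x y => by simp [ha], ?_, ?_, ?_⟩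
  · have := hWp P.2.1 P.2.2 u
    simp only at this ⊢
    rw [this]
  · have h : ∀ x y, deriv (fun s : ℝ => a (0, s, 0) x y) 0 = -H₁ (x, y) := fun x y => by
      have h1 := ((hasDerivAt_id (0 : ℝ)).mul_const (H₁ (x, y))).neg.add
        ((((hasDerivAt_id (0 : ℝ)).pow 2).mul_const (H₃ (x, y))).const_mul k)
      have h2 : (fun s : ℝ => a (0, s, 0) x y) =
          fun s => -(s * H₁ (x, y)) + k * (s ^ 2 * H₃ (x, y)) := by
        funext s
        simp [ha]
      rw [h2]
      refine h1.deriv.trans ?_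
      simp
    intro x
    simp only [h, intervalIntegral.integral_neg]
    rw [noResonantTerms_homSol per₁ sm₁.continuous hq x, neg_zero]
  · have h : ∀ x y, deriv (fun s : ℝ => a (0, 0, s) x y) 0 = -H₂ (x, y) := fun x y => by
      have h1 := ((hasDerivAt_id (0 : ℝ)).mul_const (H₂ (x, y))).neg
      have h2 : (fun s : ℝ => a (0, 0, s) x y) = fun s => -(s * H₂ (x, y)) := by
        funext s
        simp [ha]
      rw [h2]
      refine h1.deriv.trans ?_
      simp
    intro x
    simp only [h, intervalIntegral.integral_neg]
    rw [noResonantTerms_homSol per₂ sm₂.continuous hq x, neg_zero]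
  -- the estimates
  refine ⟨1 / (4 * (B : ℝ) ^ 2), by positivity,
    11 * (B : ℝ) ^ 4 * max 1 (gronwallBound 0 (B * B : NNReal) 1 q), fun P hP => ?_⟩
  obtain ⟨hσ, hη, hε⟩ := abs_le_paramSize P
  set ρ := paramSize P with hρ
  have hρ0 : 0 ≤ ρ := (abs_nonneg _).trans hη
  have hB2 : (1 : ℝ) ≤ B ^ 2 := one_le_pow₀ hB
  have hBρ : 4 * (B : ℝ) ^ 2 * ρ ≤ 1 := by
    rw [le_div_iff₀ (by positivity)] at hP
    linarith
  have hρ1 : ρ ≤ 1 := by nlinarith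
  have hρ2 : ρ ^ 2 ≤ ρ := by nlinarith
  -- One bound for the quadratic part of `a` and for that of its `x`-derivative.
  have hquad : ∀ {c d : ℝ}, |c| ≤ B → |d| ≤ B →
      |k * (P.2.1 ^ 2 * c + P.2.2 * P.2.1 * d)| ≤ 2 * B ^ 2 * ρ ^ 2 := fun {c d} hc hd => by
    rw [abs_mul]
    calc |k| * |P.2.1 ^ 2 * c + P.2.2 * P.2.1 * d| ≤ B * (ρ ^ 2 * B + ρ * ρ * B) := by
          refine mul_le_mul hBk ((abs_add_le _ _).trans ?_) (abs_nonneg _) hB0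
          rw [abs_mul, abs_mul, abs_mul, abs_pow]
          gcongr
      _ = _ := by ring
  have haB : ∀ x y, |a P x y| ≤ 4 * B ^ 2 * ρ := fun x y => by
    have h1 : |-(P.2.1 * H₁ (x, y)) - P.2.2 * H₂ (x, y)| ≤ ρ * B + ρ * B := by
      refine (abs_sub _ _).trans ?_
      rw [abs_neg, abs_mul, abs_mul]
      gcongr
      exacts [hB₁ _, hB₂ _]
    have h2 := (abs_add_le _ _).trans (add_le_add h1 (hquad (hB₃ (x, y)) (hB₄ (x, y))))
    refine h2.trans ?_
    have h3 : ρ * (B : ℝ) ≤ ρ * B ^ 2 := by gcongr; nlinarith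
    have h4 : (B : ℝ) ^ 2 * ρ ^ 2 ≤ B ^ 2 * ρ := by gcongr
    linarith
  have haxB : ∀ x y, |deriv (fun x' => a P x' y) x| ≤ 3 * B ^ 2 * ρ := fun x y => by
    rw [hax]
    have h1 : |-(P.2.1 * (k * (f x - f₀)))| ≤ ρ * (B * B) := by
      rw [abs_neg, abs_mul, abs_mul]
      gcongr
      exact hBf' x
    refine (abs_add_le _ _).trans ((add_le_add h1 (hquad (hB₃' x y) (hB₄' x y))).trans ?_)
    have h4 : (B : ℝ) ^ 2 * ρ ^ 2 ≤ B ^ 2 * ρ := by gcongr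
    linarith
  have hres : ∀ x y, |((p : ℝ) / q + P.1 + P.2.1 * f x + P.2.2 * g y) *
      (1 + deriv (fun x' => a P x' y) x) + deriv (fun y' => a P x y') y
      - ((p : ℝ) / q + (P.1 + P.2.1 * f₀ + P.2.2 * g₀ + -k * (P.2.1 ^ 2 * M
        + P.2.2 * P.2.1 * R (x + a P x y - (p : ℝ) / q * y))))| ≤ 11 * B ^ 4 * ρ ^ 3 := by
    intro x y
    have h1 := hay P x y
    have h2 := hax P x y
    have h3 : |R (x + a P x y - (p : ℝ) / q * y) - R (x - (p : ℝ) / q * y)| ≤ B * |a P x y| := by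
      have := hBR.dist_le_mul (x + a P x y - (p : ℝ) / q * y) (x - (p : ℝ) / q * y)
      rw [Real.dist_eq, Real.dist_eq] at this
      convert! this using 3
      ring
    have h4 := abs_averaging_remainder_le hB hρ0 hσ hη hε hBk (hBf x) (hBg y) (haxB x y)
      (hquad (hB₃' x y) (hB₄' x y)) (haB x y) h3
    -- By `hay` and `hax`, everything outside the three remainder terms cancels identically.
    refine le_of_eq_of_le (congrArg abs ?_) h4
    rw [h2] at h1 ⊢
    linear_combination h1
  refine ⟨fun x y => ?_, fun x y => (hres x y).trans ?_, ?_⟩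
  · have h1 := (abs_le.1 (haxB x y)).1
    nlinarith
  · have := le_max_left 1 (gronwallBound 0 (B * B : NNReal) 1 q)
    have h0 : 0 ≤ 11 * (B : ℝ) ^ 4 * ρ ^ 3 := by positivity
    nlinarith
  have hXL : ∀ y, LipschitzWith (‖P.2.1‖₊ * B)
      fun x => (p : ℝ) / q + P.1 + P.2.1 * f x + P.2.2 * g y := fun y =>
    LipschitzWith.of_dist_le_mul fun x x' => by
      have h1 := hBfL.dist_le_mul x x'
      rw [Real.dist_eq] at h1 ⊢
      rw [show (p : ℝ) / q + P.1 + P.2.1 * f x + P.2.2 * g y -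
        ((p : ℝ) / q + P.1 + P.2.1 * f x' + P.2.2 * g y) = P.2.1 * (f x - f x') by ring, abs_mul,
        NNReal.coe_mul, coe_nnnorm, Real.norm_eq_abs, mul_assoc]
      gcongr
  obtain ⟨F, hF, hFγ⟩ := exists_isPoincareMap
    (X := fun x y => (p : ℝ) / q + P.1 + P.2.1 * f x + P.2.2 * g y)
    (L := (|(p : ℝ) / q + P.1| + |P.2.1| * B + |P.2.2| * B).toNNReal) hXL
    (fun x => by have := hg.continuous; fun_prop)
    (fun x y => by
      refine le_trans ?_ (Real.le_coe_toNNReal _)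
      refine (abs_add_three _ _ _).trans ?_
      rw [abs_mul, abs_mul]
      gcongr
      exacts [hBf x, hBg y])
    (fun x y => by simp only [hgp y])
  -- Only the term with `R` varies with `u`. Since `|η|, |ε| ≤ 1`, the Lipschitz constant, and with
  -- it the Grönwall factor, is independent of `P`.
  have hZL : LipschitzWith (B * B) fun u => P.1 + P.2.1 * f₀ + P.2.2 * g₀
      + -k * (P.2.1 ^ 2 * M + P.2.2 * P.2.1 * R u) := LipschitzWith.of_dist_le_mul fun u v => by
    have h1 := hBR.dist_le_mul u v
    rw [Real.dist_eq] at h1 ⊢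
    rw [show P.1 + P.2.1 * f₀ + P.2.2 * g₀ + -k * (P.2.1 ^ 2 * M + P.2.2 * P.2.1 * R u) -
      (P.1 + P.2.1 * f₀ + P.2.2 * g₀ + -k * (P.2.1 ^ 2 * M + P.2.2 * P.2.1 * R v)) =
      -k * (P.2.2 * P.2.1) * (R u - R v) by ring, abs_mul, abs_mul, abs_neg, abs_mul,
      NNReal.coe_mul]
    calc |k| * (|P.2.2| * |P.2.1|) * |R u - R v| ≤ B * (1 * 1) * (B * dist u v) := by
          gcongr
          exacts [hε.trans hρ1, hη.trans hρ1]
      _ = _ := by ring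
  obtain ⟨c, hc⟩ := hRp.exists_abs_le hRs.continuous
  obtain ⟨ψ, hψ⟩ := exists_isFlowMap_of_bounded (T := q)
    (L := (|P.1 + P.2.1 * f₀ + P.2.2 * g₀| + |k| * (|P.2.1 ^ 2 * M| + |P.2.2 * P.2.1| * c)).toNNReal)
    hZL (fun u => by
      refine le_trans ?_ (Real.le_coe_toNNReal _)
      refine (abs_add_le _ _).trans ?_
      rw [abs_mul, abs_neg]
      gcongr
      refine (abs_add_le _ _).trans ?_
      rw [abs_mul (P.2.2 * P.2.1)]
      gcongr
      exact hc u) (Nat.cast_nonneg q)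
  refine ⟨F, ψ, hF, hψ, fun x => ?_⟩
  have h1 := iterate_poincareMap_sub_flow_le hq hFγ (haD P) (haP P) hZL hψ hres x
  refine h1.trans ?_
  have := le_max_right 1 (gronwallBound 0 (B * B : NNReal) 1 q)
  calc _ ≤ 11 * (B : ℝ) ^ 4 * ρ ^ 3 * max 1 (gronwallBound 0 (B * B : NNReal) 1 q) := by gcongr
    _ = _ := by ring

/-! ### Fourier series of smooth periodic functions -/

theorem fourierCoef_eq_integral (h : ℝ → ℝ) (k : ℤ) :
    fourierCoef h k =
      ∫ t in (0 : ℝ)..1, Complex.exp (-(2 * (Real.pi : ℂ) * Complex.I * k * t)) * h t := by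
  rw [fourierCoef, fourierCoeffOn_eq_integral]
  simp only [sub_zero, one_div, inv_one, one_smul, smul_eq_mul]
  refine intervalIntegral.integral_congr fun t _ => ?_
  simp only [fourier_coe_apply]
  congr 2
  push_cast
  ring

theorem fourierCoef_zero (h : ℝ → ℝ) : fourierCoef h 0 = ((∫ t in (0 : ℝ)..1, h t : ℝ) : ℂ) := by
  rw [fourierCoef_eq_integral, ← intervalIntegral.integral_ofReal]
  simp

theorem fourierCoef_of_hasDerivAt {h h' : ℝ → ℝ} (hh : ∀ x, HasDerivAt h (h' x) x)
    (hc : Continuous h') (hp : Function.Periodic h 1) {k : ℤ} (hk : k ≠ 0) :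
    fourierCoef h k = 1 / (2 * (Real.pi : ℂ) * Complex.I * k) * fourierCoef h' k := by
  have h1 := fourierCoeffOn_of_hasDerivAt (zero_lt_one' ℝ) hk
    (fun x _ => (hh x).ofReal_comp) ((Complex.continuous_ofReal.comp hc).intervalIntegrable 0 1)
  have h2 : h 1 = h 0 := by simpa using hp 0
  rw [fourierCoef, h1, h2, fourierCoef]
  simp only [sub_self, mul_zero, Complex.ofReal_one, Complex.ofReal_zero, sub_zero, zero_sub,
    one_mul]
  simp only [neg_mul, one_div, inv_neg, mul_neg, neg_neg]

theorem norm_fourierCoef_le {h : ℝ → ℝ} {C : ℝ} (hC : ∀ x, |h x| ≤ C) (k : ℤ) :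
    ‖fourierCoef h k‖ ≤ C := by
  rw [fourierCoef_eq_integral]
  have := intervalIntegral.norm_integral_le_of_norm_le_const (a := 0) (b := 1) (C := C)
    (f := fun t : ℝ => Complex.exp (-(2 * (Real.pi : ℂ) * Complex.I * k * t)) * h t) fun x _ => by
      rw [norm_mul, Complex.norm_exp, Complex.norm_real]
      simpa using hC x
  simpa using this

/-- Two integrations by parts, with boundary terms cancelling by periodicity, give decay like `1 /
k²`. -/
theorem summable_fourierCoef {h : ℝ → ℝ} (hh : ContDiff ℝ ∞ h) (hp : Function.Periodic h 1) :
    Summable (fourierCoef h) := by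
  have hd : ContDiff ℝ ∞ (deriv h) := (contDiff_infty_iff_deriv.1 hh).2
  have hdd : ContDiff ℝ ∞ (deriv (deriv h)) := (contDiff_infty_iff_deriv.1 hd).2
  have per : ∀ {u : ℝ → ℝ}, Function.Periodic u 1 → Function.Periodic (deriv u) 1 :=
    fun {u} hu x => by rw [← deriv_comp_add_const, funext hu]
  obtain ⟨C, hC⟩ := (per (per hp)).exists_abs_le hdd.continuous
  have hsum : Summable fun k : ℤ => C * (1 / (k : ℝ) ^ 2) :=
    (Real.summable_one_div_int_pow.2 one_lt_two).mul_left C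
  refine Summable.of_norm_bounded_eventually hsum ?_
  filter_upwards [(Set.finite_singleton (0 : ℤ)).compl_mem_cofinite] with k hk
  have hk' : k ≠ 0 := hk
  rw [fourierCoef_of_hasDerivAt (fun x => (hh.differentiable (by simp) x).hasDerivAt) hd.continuous
      hp hk', fourierCoef_of_hasDerivAt (fun x => (hd.differentiable (by simp) x).hasDerivAt)
      hdd.continuous (per hp) hk', ← mul_assoc, norm_mul, mul_comm]
  have hkr : (0 : ℝ) < (k : ℝ) ^ 2 := by positivity
  refine mul_le_mul (norm_fourierCoef_le hC k) ?_ (norm_nonneg _)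
    ((abs_nonneg _).trans (hC 0))
  have hnorm : ‖1 / (2 * (Real.pi : ℂ) * Complex.I * k) * (1 / (2 * (Real.pi : ℂ) * Complex.I * k))‖ =
      1 / (2 * Real.pi) ^ 2 * (1 / (k : ℝ) ^ 2) := by
    simp only [norm_mul, norm_div, norm_one, Complex.norm_I, Complex.norm_real, Complex.norm_intCast,
      Complex.norm_ofNat, Real.norm_eq_abs, abs_of_pos Real.pi_pos]
    rw [← sq_abs (k : ℝ)]
    ring
  rw [hnorm]
  have hpi : (1 : ℝ) ≤ (2 * Real.pi) ^ 2 := by nlinarith [Real.pi_gt_three]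
  exact mul_le_of_le_one_left (by positivity) (div_le_one_of_le₀ hpi (by positivity))

theorem hasSum_fourierCoef {h : ℝ → ℝ} (hc : Continuous h) (hp : Function.Periodic h 1)
    (hs : Summable (fourierCoef h)) (x : ℝ) :
    HasSum (fun k : ℤ => fourierCoef h k * Complex.exp (2 * (Real.pi : ℂ) * Complex.I * k * x))
      (h x : ℂ) := by
  have hp' : Function.Periodic (fun t => (h t : ℂ)) 1 := fun t => by simp only [hp t]
  let H : C(AddCircle (1 : ℝ), ℂ) := ⟨hp'.lift, continuous_coinduced_dom.2
    (Complex.continuous_ofReal.comp hc)⟩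
  have hco : fourierCoeff H = fourierCoef h := by
    funext k
    rw [fourierCoeff_eq_intervalIntegral _ _ 0, fourierCoef_eq_integral]
    simp only [zero_add, one_div, inv_one, one_smul, smul_eq_mul]
    refine intervalIntegral.integral_congr fun t _ => ?_
    simp only [fourier_coe_apply]
    congr 1
    congr 1
    push_cast
    ring
  have h1 := has_pointwise_sum_fourier_series_of_summable (f := H) (by rw [hco]; exact hs)
    (x : AddCircle (1 : ℝ))
  rw [hco] at h1
  convert! h1 using 3 with k
  rw [fourier_coe_apply]
  simp

/-- Integration of the Fourier series of `h` along a line against a continuous function. -/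
theorem hasSum_integral_fourierCoef {h G : ℝ → ℝ} (hc : Continuous h) (hp : Function.Periodic h 1)
    (hs : Summable (fourierCoef h)) (hG : Continuous G) (u θ T : ℝ) :
    HasSum (fun k : ℤ => fourierCoef h k * Complex.exp (2 * (Real.pi : ℂ) * Complex.I * k * u) *
        ∫ s in (0 : ℝ)..T, Complex.exp (2 * (Real.pi : ℂ) * Complex.I * k * (θ * s)) * G s)
      ((∫ s in (0 : ℝ)..T, h (u + θ * s) * G s : ℝ) : ℂ) := by
  have hGi : IntervalIntegrable (fun s => |G s|) MeasureTheory.volume 0 T :=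
    (continuous_abs.comp hG).intervalIntegrable _ _
  have h1 := intervalIntegral.hasSum_integral_of_dominated_convergence
    (μ := MeasureTheory.volume) (a := 0) (b := T)
    (F := fun (k : ℤ) (s : ℝ) => fourierCoef h k *
      Complex.exp (2 * (Real.pi : ℂ) * Complex.I * k * (u + θ * s : ℝ)) * G s)
    (f := fun s => ((h (u + θ * s) * G s : ℝ) : ℂ))
    (fun k s => ‖fourierCoef h k‖ * |G s|)
    (fun k => by
      refine Continuous.aestronglyMeasurable ?_
      fun_prop)
    (fun k => Filter.Eventually.of_forall fun s _ => by
      rw [norm_mul, norm_mul, Complex.norm_exp, Complex.norm_real]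
      simp)
    (Filter.Eventually.of_forall fun s _ => hs.norm.mul_right _)
    (by
      simp only [tsum_mul_right]
      exact hGi.const_mul _)
    (Filter.Eventually.of_forall fun s _ => by
      rw [Complex.ofReal_mul]
      exact (hasSum_fourierCoef hc hp hs (u + θ * s)).mul_right _)
  rw [intervalIntegral.integral_ofReal] at h1
  convert! h1 using 2 with k
  rw [← intervalIntegral.integral_const_mul]
  refine intervalIntegral.integral_congr fun s _ => ?_
  have h2 : Complex.exp (2 * (Real.pi : ℂ) * Complex.I * k * (u + θ * s : ℝ)) =
      Complex.exp (2 * (Real.pi : ℂ) * Complex.I * k * u) *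
        Complex.exp (2 * (Real.pi : ℂ) * Complex.I * k * (θ * s)) := by
    rw [← Complex.exp_add]
    congr 1
    push_cast
    ring
  simp only [h2]
  ring

theorem fourierCoef_sub_mean {f : ℝ → ℝ} (hf : Continuous f) (k : ℤ) :
    fourierCoef (fun x => f x - ∫ t in (0 : ℝ)..1, f t) k = if k = 0 then 0 else fourierCoef f k := by
  split_ifs with hk
  · subst hk
    rw [fourierCoef_zero, intervalIntegral.integral_sub (hf.intervalIntegrable _ _)
      intervalIntegrable_const]
    simp
  · set f₀ := ∫ t in (0 : ℝ)..1, f t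
    have h1 : fourierCoef (fun _ => f₀) k = 0 := by
      rw [fourierCoef_of_hasDerivAt (h' := fun _ => 0) (fun x => hasDerivAt_const x f₀)
        continuous_const (fun _ => rfl) hk, fourierCoef_eq_integral]
      simp
    rw [← sub_zero (fourierCoef f k), ← h1, fourierCoef_eq_integral, fourierCoef_eq_integral,
      fourierCoef_eq_integral, ← intervalIntegral.integral_sub]
    · refine intervalIntegral.integral_congr fun t _ => ?_
      push_cast
      ring
    · refine Continuous.intervalIntegrable ?_ _ _
      fun_prop
    · refine Continuous.intervalIntegrable ?_ _ _
      fun_prop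

/-! ### Fourier series of the quadratic averages. -/

/-- The series of `f` minus its mean is integrated against `f`; subtracting the mean removes the
index `0`. -/
theorem hasSum_fourierCoef_mul_fourierCoef_neg {f : ℝ → ℝ} (hf : ContDiff ℝ ∞ f)
    (hp : Function.Periodic f 1) :
    HasSum (fun k : {k : ℤ // k ≠ 0} => fourierCoef f k * fourierCoef f (-k))
      ((∫ t in (0 : ℝ)..1, f t * (f t - ∫ t in (0 : ℝ)..1, f t) : ℝ) : ℂ) := by
  have hp' : Function.Periodic (fun x => f x - ∫ t in (0 : ℝ)..1, f t) 1 := fun x => by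
    simp only [hp x]
  have hs' : ContDiff ℝ ∞ (fun x => f x - ∫ t in (0 : ℝ)..1, f t) := hf.sub contDiff_const
  have h1 := hasSum_integral_fourierCoef hs'.continuous hp' (summable_fourierCoef hs' hp')
    hf.continuous 0 1 1
  rw [← Function.Injective.hasSum_iff (g := ((↑) : {k : ℤ // k ≠ 0} → ℤ)) Subtype.val_injective]
    at h1
  · convert! h1 using 2 with k
    · simp only [Function.comp_apply]
      rw [fourierCoef_sub_mean hf.continuous, if_neg k.2, fourierCoef_eq_integral f (-k)]
      simp
    · refine intervalIntegral.integral_congr fun t _ => ?_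
      simp only [zero_add, one_mul]
      ring
  · intro k hk
    have : k = 0 := by
      by_contra h
      exact hk ⟨⟨k, h⟩, rfl⟩
    rw [fourierCoef_sub_mean hf.continuous, if_pos this, zero_mul, zero_mul]

/-- Shifting `s` by `1` multiplies the integrand by `c = exp (2πi k p / q)` but preserves its
integral over the period `q`. Coprimality gives `c ≠ 1`. -/
theorem integral_exp_mul_eq_zero {p q : ℕ} (hq : 0 < q) (hpq : Nat.Coprime p q) {g : ℝ → ℝ}
    (hg : Function.Periodic g 1) {k : ℤ} (hk : ¬ (q : ℤ) ∣ k) :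
    ∫ s in (0 : ℝ)..q, Complex.exp (2 * (Real.pi : ℂ) * Complex.I * k * (((p : ℝ) / q : ℝ) * s)) *
      g s = 0 := by
  have hq' : (q : ℂ) ≠ 0 := by exact_mod_cast hq.ne'
  set c : ℂ := Complex.exp (2 * (Real.pi : ℂ) * Complex.I * k * ((p : ℝ) / q : ℝ)) with hc
  have hc1 : c ≠ 1 := by
    rw [hc, Ne, Complex.exp_eq_one_iff]
    rintro ⟨n, hn⟩
    have h1 : (2 * (Real.pi : ℂ) * Complex.I) ≠ 0 := Complex.two_pi_I_ne_zero
    have h2 : ((k * p : ℤ) : ℂ) = (n * q : ℤ) := by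
      push_cast at hn ⊢
      field_simp at hn
      linear_combination hn
    have h3 : k * p = n * q := by exact_mod_cast h2
    have h4 : (q : ℤ) ∣ k * p := ⟨n, by rw [h3, mul_comm]⟩
    have h5 : IsCoprime (q : ℤ) p := Nat.isCoprime_iff_coprime.2 hpq.symm
    exact hk (h5.dvd_of_dvd_mul_right h4)
  set β : ℝ → ℂ := fun s =>
    Complex.exp (2 * (Real.pi : ℂ) * Complex.I * k * (((p : ℝ) / q : ℝ) * s)) * g s with hβ
  have hβ1 : ∀ s, β (s + 1) = c * β s := fun s => by
    simp only [hβ, hc, hg s]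
    rw [← mul_assoc (Complex.exp _) (Complex.exp _), ← Complex.exp_add]
    congr 2
    push_cast
    ring
  have hβq : Function.Periodic β q := fun s => by
    have h1 : g (s + q) = g s := by simpa using hg.nat_mul q s
    simp only [hβ, h1]
    congr 1
    rw [Complex.exp_eq_exp_iff_exists_int]
    refine ⟨k * p, ?_⟩
    push_cast
    field_simp
  have h1 : ∫ s in (0 : ℝ)..q, β s = c * ∫ s in (0 : ℝ)..q, β s := by
    rw [← intervalIntegral.integral_const_mul]
    simp only [← hβ1]
    rw [intervalIntegral.integral_comp_add_right, zero_add, add_comm,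
      hβq.intervalIntegral_add_eq 1 0, zero_add]
  have h2 : (1 - c) * ∫ s in (0 : ℝ)..q, β s = 0 := by linear_combination h1
  exact (mul_eq_zero.1 h2).resolve_left (sub_ne_zero.2 hc1.symm)

/-- For `k = m q` the exponential is `exp (2πi m p s)`, so the integrand has period `1` and the
integral is `q` equal pieces. -/
theorem integral_exp_mul_eq_fourierCoef {p q : ℕ} (hq : 0 < q) {g : ℝ → ℝ}
    (hg : Function.Periodic g 1) (hgc : Continuous g) (m : ℤ) :
    ∫ s in (0 : ℝ)..q, Complex.exp (2 * (Real.pi : ℂ) * Complex.I * (m * q : ℤ) *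
      (((p : ℝ) / q : ℝ) * s)) * g s = q * fourierCoef g (-(m * p)) := by
  have hq' : (q : ℂ) ≠ 0 := by exact_mod_cast hq.ne'
  set β : ℝ → ℂ := fun s =>
    Complex.exp (2 * (Real.pi : ℂ) * Complex.I * (m * q : ℤ) * (((p : ℝ) / q : ℝ) * s)) * g s
    with hβ
  have hβp : Function.Periodic β 1 := fun s => by
    simp only [hβ, hg s]
    congr 1
    rw [Complex.exp_eq_exp_iff_exists_int]
    refine ⟨m * p, ?_⟩
    push_cast
    field_simp
  have hβc : Continuous β := by fun_prop
  have h1 := hβp.intervalIntegral_add_zsmul_eq q 0 fun _ _ => hβc.intervalIntegrable _ _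
  simp only [zero_add, zsmul_eq_mul, Int.cast_natCast, mul_one] at h1
  rw [h1, fourierCoef_eq_integral]
  congr 1
  refine intervalIntegral.integral_congr fun s _ => ?_
  simp only [hβ]
  congr 2
  push_cast
  field_simp

theorem hasSum_resonant {p q : ℕ} (hq : 0 < q) (hpq : Nat.Coprime p q)
    {f g : ℝ → ℝ} (hf : ContDiff ℝ ∞ f) (hfp : Function.Periodic f 1) (hg : Continuous g)
    (hgp : Function.Periodic g 1) (u : ℝ) :
    HasSum (fun m : {m : ℤ // m ≠ 0} => fourierCoef f (m * q) * fourierCoef g (-(m * p)) *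
        Complex.exp (2 * (Real.pi : ℂ) * Complex.I * (m : ℂ) * (q : ℂ) * (u : ℂ)))
      ((orbitAvg p q (fun z => g z.2 * (f z.1 - ∫ t in (0 : ℝ)..1, f t)) (u, 0) : ℝ) : ℂ) := by
  have hq' : (q : ℂ) ≠ 0 := by exact_mod_cast hq.ne'
  have hp' : Function.Periodic (fun x => f x - ∫ t in (0 : ℝ)..1, f t) 1 := fun x => by
    simp only [hfp x]
  have hs' : ContDiff ℝ ∞ (fun x => f x - ∫ t in (0 : ℝ)..1, f t) := hf.sub contDiff_const
  have h1 := (hasSum_integral_fourierCoef hs'.continuous hp' (summable_fourierCoef hs' hp')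
    hg u ((p : ℝ) / q) q).mul_left (1 / (q : ℂ))
  have hinj : Function.Injective fun m : {m : ℤ // m ≠ 0} => (m : ℤ) * q := fun m n h => by
    have : (q : ℤ) ≠ 0 := by exact_mod_cast hq.ne'
    exact Subtype.ext (mul_right_cancel₀ this h)
  rw [← hinj.hasSum_iff] at h1
  · convert! h1 using 2 with m
    · simp only [Function.comp_apply]
      have hm : (m : ℤ) * q ≠ 0 := mul_ne_zero m.2 (by exact_mod_cast hq.ne')
      rw [fourierCoef_sub_mean hf.continuous, if_neg hm, integral_exp_mul_eq_fourierCoef hq hgp hg]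
      push_cast
      rw [← mul_assoc (2 * (Real.pi : ℂ) * Complex.I)]
      field_simp
    · rw [orbitAvg]
      push_cast
      congr 2
      refine intervalIntegral.integral_congr fun s _ => ?_
      simp only [zero_add]
      ring
  · intro k hk
    rw [fourierCoef_sub_mean hf.continuous]
    split_ifs with h0
    · simp
    · rw [integral_exp_mul_eq_zero hq hpq hgp, mul_zero, mul_zero]
      rintro ⟨m, rfl⟩
      exact hk ⟨⟨m, right_ne_zero_of_mul h0⟩, mul_comm _ _⟩

/-! ### The smoothed block function -/

theorem measurable_blockForcing (l : ℝ) : Measurable (blockForcing l) :=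
  Measurable.ite (measurableSet_lt measurable_fract measurable_const) measurable_const
    measurable_const

theorem abs_blockForcing_le (l t : ℝ) : |blockForcing l t| ≤ 1 := by
  unfold blockForcing
  split_ifs <;> simp

theorem periodic_blockForcing (l : ℝ) : Function.Periodic (blockForcing l) 1 := fun t => by
  simp [blockForcing]

theorem continuous_gaussKernel (α : ℝ) : Continuous (gaussKernel α) := by
  unfold gaussKernel
  fun_prop

theorem integrable_gaussKernel {α : ℝ} (hα : 0 < α) :
    MeasureTheory.Integrable (gaussKernel α) :=
  (integrable_exp_neg_mul_sq hα).const_mul _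

theorem smoothForcing_apply (α l x : ℝ) :
    smoothForcing α l x = ∫ t, gaussKernel α t * blockForcing l (x - t) := rfl

theorem periodic_smoothForcing (α l : ℝ) : Function.Periodic (smoothForcing α l) 1 := fun x => by
  simp only [smoothForcing_apply, add_sub_right_comm, periodic_blockForcing l _]

theorem continuous_smoothForcing {α : ℝ} (hα : 0 < α) (l : ℝ) :
    Continuous (smoothForcing α l) := by
  -- The variable `x` is moved into the continuous factor, away from the discontinuous block.
  have h1 : smoothForcing α l = fun x => ∫ t, gaussKernel α (x - t) * blockForcing l t := by
    funext x
    exact MeasureTheory.convolution_eq_swap _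
  rw [h1]
  refine continuous_iff_continuousAt.2 fun x₀ => ?_
  -- The bound comes from `(x - s)² ≥ (s - x₀)² / 2 - 1` for `|x - x₀| ≤ 1`.
  refine MeasureTheory.continuousAt_of_dominated
    (bound := fun s => √(α / Real.pi) * Real.exp α * Real.exp (-(α / 2) * (s - x₀) ^ 2))
    (Filter.Eventually.of_forall fun x => ?_) ?_ ?_ (Filter.Eventually.of_forall fun s => ?_)
  · exact (((continuous_gaussKernel α).comp (by fun_prop)).measurable.mul
      (measurable_blockForcing l)).aestronglyMeasurable
  · filter_upwards [Metric.ball_mem_nhds x₀ one_pos] with x hx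
    refine Filter.Eventually.of_forall fun s => ?_
    rw [Metric.mem_ball, Real.dist_eq] at hx
    have h2 : (x - x₀) ^ 2 ≤ 1 := by
      rw [← sq_abs]
      exact pow_le_one₀ (abs_nonneg _) hx.le
    rw [norm_mul, Real.norm_eq_abs, Real.norm_eq_abs, mul_assoc √_, ← Real.exp_add]
    refine (mul_le_of_le_one_right (abs_nonneg _) (abs_blockForcing_le l s)).trans ?_
    rw [gaussKernel, abs_of_nonneg (by positivity)]
    gcongr
    nlinarith [sq_nonneg ((x - s) + (x - x₀))]
  · exact ((integrable_exp_neg_mul_sq (half_pos hα)).comp_sub_right x₀).const_mul _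
  · exact (((continuous_gaussKernel α).comp (by fun_prop)).mul continuous_const).continuousAt

theorem integral_gaussKernel_mul_exp {α : ℝ} (hα : 0 < α) (k : ℤ) :
    ∫ t, (gaussKernel α t : ℂ) * Complex.exp (-(2 * (Real.pi : ℂ) * Complex.I * k * t)) =
      Complex.exp (-((Real.pi : ℂ) ^ 2 * (k : ℂ) ^ 2 / (α : ℂ))) := by
  have h1 := fourierIntegral_gaussian (b := α) (by simpa using hα) (-(2 * (Real.pi : ℂ) * k))
  have hα' : (α : ℂ) ≠ 0 := by exact_mod_cast hα.ne'
  have h2 : ((Real.pi : ℂ) / α) ^ (1 / 2 : ℂ) = (√(Real.pi / α) : ℝ) := by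
    rw [Real.sqrt_eq_rpow, Complex.ofReal_cpow (by positivity)]
    push_cast
    rfl
  have h3 : √(α / Real.pi) * √(Real.pi / α) = 1 := by
    rw [← Real.sqrt_mul (by positivity), div_mul_div_comm, mul_comm, div_self (by positivity),
      Real.sqrt_one]
  have h4 : ∀ t : ℝ, (gaussKernel α t : ℂ) *
      Complex.exp (-(2 * (Real.pi : ℂ) * Complex.I * k * t)) = (√(α / Real.pi) : ℝ) *
      (Complex.exp (Complex.I * (-(2 * (Real.pi : ℂ) * k)) * t) *
        Complex.exp (-(α : ℂ) * (t : ℂ) ^ 2)) := fun t => by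
    rw [gaussKernel]
    push_cast
    rw [show -(2 * (Real.pi : ℂ) * Complex.I * k * t) =
      Complex.I * (-(2 * (Real.pi : ℂ) * k)) * t by ring]
    ring
  simp only [h4]
  rw [MeasureTheory.integral_const_mul, h1, h2, ← mul_assoc, ← Complex.ofReal_mul, h3,
    Complex.ofReal_one, one_mul]
  congr 1
  field_simp
  ring

/-- By Fubini, translating the block by `t` multiplies its coefficient by `exp (-2πi k t)`;
integrating against the Gaussian leaves its Fourier transform. -/
theorem fourierCoef_smoothForcing {α : ℝ} (hα : 0 < α) (l : ℝ) (k : ℤ) :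
    fourierCoef (smoothForcing α l) k =
      Complex.exp (-((Real.pi : ℂ) ^ 2 * (k : ℂ) ^ 2 / (α : ℂ))) *
        fourierCoef (blockForcing l) k := by
  have hexp : Continuous fun x : ℝ => Complex.exp (-(2 * (Real.pi : ℂ) * Complex.I * k * x)) := by
    fun_prop
  have hint : MeasureTheory.Integrable (Function.uncurry fun x t : ℝ =>
      Complex.exp (-(2 * (Real.pi : ℂ) * Complex.I * k * x)) *
        ((gaussKernel α t : ℂ) * (blockForcing l (x - t) : ℂ)))
      ((MeasureTheory.volume.restrict (Set.uIoc (0 : ℝ) 1)).prod MeasureTheory.volume) := by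
    have h1 : MeasureTheory.Integrable (fun z : ℝ × ℝ => (1 : ℝ) * gaussKernel α z.2)
        ((MeasureTheory.volume.restrict (Set.uIoc (0 : ℝ) 1)).prod MeasureTheory.volume) :=
      (MeasureTheory.integrableOn_const (s := Set.uIoc (0 : ℝ) 1) (C := (1 : ℝ))
        (by simp [Set.uIoc])).mul_prod (integrable_gaussKernel hα)
    refine h1.mono' ?_ (Filter.Eventually.of_forall fun z => ?_)
    · have m1 : Measurable fun z : ℝ × ℝ => blockForcing l (z.1 - z.2) :=
        (measurable_blockForcing l).comp (by fun_prop)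
      have m2 : Measurable fun z : ℝ × ℝ => gaussKernel α z.2 :=
        (continuous_gaussKernel α).measurable.comp measurable_snd
      have m3 : Measurable fun z : ℝ × ℝ =>
          Complex.exp (-(2 * (Real.pi : ℂ) * Complex.I * k * z.1)) :=
        hexp.measurable.comp measurable_fst
      exact (m3.mul ((Complex.measurable_ofReal.comp m2).mul
        (Complex.measurable_ofReal.comp m1))).aestronglyMeasurable
    · simp only [Function.uncurry, norm_mul, Complex.norm_exp, Complex.norm_real, Real.norm_eq_abs]
      have h0 : 0 ≤ gaussKernel α z.2 := by
        unfold gaussKernel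
        positivity
      rw [abs_of_nonneg h0]
      have := mul_le_of_le_one_right h0 (abs_blockForcing_le l (z.1 - z.2))
      simpa using this
  have hinner : ∀ t : ℝ, ∫ x in (0 : ℝ)..1,
      Complex.exp (-(2 * (Real.pi : ℂ) * Complex.I * k * x)) *
        ((gaussKernel α t : ℂ) * (blockForcing l (x - t) : ℂ)) =
      (gaussKernel α t : ℂ) * Complex.exp (-(2 * (Real.pi : ℂ) * Complex.I * k * t)) *
        fourierCoef (blockForcing l) k := fun t => by
    set β : ℝ → ℂ := fun x => Complex.exp (-(2 * (Real.pi : ℂ) * Complex.I * k * x)) *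
      blockForcing l x with hβ
    have hβp : Function.Periodic β 1 := fun x => by
      simp only [hβ, periodic_blockForcing l x]
      congr 1
      rw [Complex.exp_eq_exp_iff_exists_int]
      refine ⟨-k, ?_⟩
      push_cast
      ring
    have h1 : ∀ x : ℝ, Complex.exp (-(2 * (Real.pi : ℂ) * Complex.I * k * x)) *
        ((gaussKernel α t : ℂ) * (blockForcing l (x - t) : ℂ)) =
        (gaussKernel α t : ℂ) * Complex.exp (-(2 * (Real.pi : ℂ) * Complex.I * k * t)) *
          β (x - t) := fun x => by
      have h2 : Complex.exp (-(2 * (Real.pi : ℂ) * Complex.I * k * x)) =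
          Complex.exp (-(2 * (Real.pi : ℂ) * Complex.I * k * t)) *
            Complex.exp (-(2 * (Real.pi : ℂ) * Complex.I * k * (x - t : ℝ))) := by
        rw [← Complex.exp_add]
        congr 1
        push_cast
        ring
      rw [h2]
      ring
    simp only [h1]
    rw [intervalIntegral.integral_const_mul, intervalIntegral.integral_comp_sub_right,
      show (1 : ℝ) - t = 0 - t + 1 by ring, hβp.intervalIntegral_add_eq (0 - t) 0, zero_add,
      fourierCoef_eq_integral]
  rw [fourierCoef_eq_integral]
  calc _ = ∫ x in (0 : ℝ)..1, ∫ t, Complex.exp (-(2 * (Real.pi : ℂ) * Complex.I * k * x)) *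
        ((gaussKernel α t : ℂ) * (blockForcing l (x - t) : ℂ)) := by
        refine intervalIntegral.integral_congr fun x _ => ?_
        rw [MeasureTheory.integral_const_mul, smoothForcing_apply, ← integral_complex_ofReal]
        simp only [Complex.ofReal_mul]
    _ = ∫ t, ∫ x in (0 : ℝ)..1, Complex.exp (-(2 * (Real.pi : ℂ) * Complex.I * k * x)) *
        ((gaussKernel α t : ℂ) * (blockForcing l (x - t) : ℂ)) :=
        MeasureTheory.intervalIntegral_integral_swap hint
    _ = _ := by
        simp only [hinner]
        rw [MeasureTheory.integral_mul_const, integral_gaussKernel_mul_exp hα]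

theorem fourierCoef_blockForcing {l : ℝ} (hl0 : 0 ≤ l) (hl1 : l ≤ 1) (k : ℤ) :
    fourierCoef (blockForcing l) k =
      ∫ t in (0 : ℝ)..l, Complex.exp (-(2 * (Real.pi : ℂ) * Complex.I * k * t)) := by
  have hint : ∀ a b : ℝ, IntervalIntegrable (fun t : ℝ =>
      Complex.exp (-(2 * (Real.pi : ℂ) * Complex.I * k * t)) * blockForcing l t)
      MeasureTheory.volume a b := fun a b => by
    refine (intervalIntegrable_const (c := (1 : ℝ))).mono_fun' ?_
      (Filter.Eventually.of_forall fun t => ?_)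
    · have h1 : Continuous fun t : ℝ =>
          Complex.exp (-(2 * (Real.pi : ℂ) * Complex.I * k * t)) := by fun_prop
      exact (h1.measurable.mul
        (Complex.measurable_ofReal.comp (measurable_blockForcing l))).aestronglyMeasurable
    · simp only [norm_mul, Complex.norm_exp, Complex.norm_real]
      simpa using abs_blockForcing_le l t
  rw [fourierCoef_eq_integral, ← intervalIntegral.integral_add_adjacent_intervals (hint 0 l)
    (hint l 1)]
  have h1 : ∫ t in (0 : ℝ)..l, Complex.exp (-(2 * (Real.pi : ℂ) * Complex.I * k * t)) *
      blockForcing l t =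
      ∫ t in (0 : ℝ)..l, Complex.exp (-(2 * (Real.pi : ℂ) * Complex.I * k * t)) :=
    intervalIntegral.integral_congr_Ioo_of_le hl0 fun t ht => by
      have : Int.fract t = t := Int.fract_eq_self.2 ⟨ht.1.le, ht.2.trans_le hl1⟩
      simp [blockForcing, this, ht.2]
  -- The end-point `1` must be left out: `Int.fract 1 = 0` lies in the block when `0 < l`.
  have h2 : ∫ t in l..(1 : ℝ), Complex.exp (-(2 * (Real.pi : ℂ) * Complex.I * k * t)) *
      blockForcing l t = ∫ t in l..(1 : ℝ), 0 :=
    intervalIntegral.integral_congr_Ioo_of_le hl1 fun t ht => by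
      have : Int.fract t = t := Int.fract_eq_self.2 ⟨hl0.trans ht.1.le, ht.2⟩
      simp [blockForcing, this, ht.1.not_gt]
  rw [h1, h2]
  simp

theorem iteratedDeriv_const_mul_cexp (c a : ℂ) (n : ℕ) :
    iteratedDeriv n (fun x : ℝ => c * Complex.exp (a * x)) =
      fun x : ℝ => a ^ n * (c * Complex.exp (a * x)) := by
  induction n with
  | zero => simp
  | succ n ih =>
    rw [iteratedDeriv_succ, ih]
    funext x
    have h1 : HasDerivAt (fun x : ℝ => a * (x : ℂ)) a x := by
      simpa using (Complex.ofRealCLM.hasDerivAt (x := x)).const_mul a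
    rw [((h1.cexp.const_mul c).const_mul (a ^ n)).deriv]
    ring

/-- The exponent is arranged to match the summability lemma for the terms of `jacobiTheta₂`. -/
theorem norm_fourierCoef_smoothForcing_le {α : ℝ} (hα : 0 < α) (l : ℝ) (k : ℤ) :
    ‖fourierCoef (smoothForcing α l) k‖ ≤ Real.exp (-Real.pi * (Real.pi / α * (k : ℝ) ^ 2)) := by
  rw [fourierCoef_smoothForcing hα, norm_mul, Complex.norm_exp]
  refine (mul_le_of_le_one_right (Real.exp_pos _).le
    (norm_fourierCoef_le (abs_blockForcing_le l) k)).trans (le_of_eq ?_)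
  congr 1
  rw [show -((Real.pi : ℂ) ^ 2 * (k : ℂ) ^ 2 / (α : ℂ)) =
    ((-(Real.pi ^ 2 * (k : ℝ) ^ 2 / α) : ℝ) : ℂ) by push_cast; ring, Complex.ofReal_re]
  ring

/-- The Gaussian decay of the coefficients beats every power of `k`, so the Fourier series can be
differentiated termwise to all orders. Continuity, known beforehand, identifies its sum with the
forcing. -/
theorem contDiff_smoothForcing {α : ℝ} (hα : 0 < α) (l : ℝ) :
    ContDiff ℝ ∞ (smoothForcing α l) := by
  have hsum : ∀ n : ℕ, Summable fun k : ℤ =>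
      (2 * Real.pi) ^ n * (|(k : ℝ)| ^ n * Real.exp (-Real.pi * (Real.pi / α * (k : ℝ) ^ 2))) :=
    fun n => by
      have h1 := summable_pow_mul_jacobiTheta₂_term_bound 0 (div_pos Real.pi_pos hα) n
      refine Summable.mul_left _ ?_
      simpa using h1
  have hs : Summable (fourierCoef (smoothForcing α l)) :=
    Summable.of_norm_bounded (by simpa using hsum 0) (norm_fourierCoef_smoothForcing_le hα l)
  have h1 : ContDiff ℝ ∞ fun x : ℝ => ∑' k : ℤ, fourierCoef (smoothForcing α l) k *
      Complex.exp (2 * (Real.pi : ℂ) * Complex.I * k * x) := by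
    refine contDiff_tsum (v := fun n (k : ℤ) =>
      (2 * Real.pi) ^ n * (|(k : ℝ)| ^ n * Real.exp (-Real.pi * (Real.pi / α * (k : ℝ) ^ 2))))
      (fun k => ?_) (fun n _ => hsum n) fun n k x _ => ?_
    · have : ContDiff ℝ ∞ fun x : ℝ => (x : ℂ) := Complex.ofRealCLM.contDiff
      fun_prop
    · rw [norm_iteratedFDeriv_eq_norm_iteratedDeriv, iteratedDeriv_const_mul_cexp]
      simp only [norm_mul, norm_pow, Complex.norm_I, Complex.norm_real, Complex.norm_intCast,
        Complex.norm_ofNat, Real.norm_eq_abs, abs_of_pos Real.pi_pos, mul_one, Complex.norm_exp]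
      rw [mul_pow, mul_assoc]
      gcongr
      refine le_trans (le_of_eq ?_) (norm_fourierCoef_smoothForcing_le hα l k)
      simp
  have h2 : smoothForcing α l = fun x : ℝ => (∑' k : ℤ, fourierCoef (smoothForcing α l) k *
      Complex.exp (2 * (Real.pi : ℂ) * Complex.I * k * x)).re := by
    funext x
    rw [(hasSum_fourierCoef (continuous_smoothForcing hα l) (periodic_smoothForcing α l) hs
      x).tsum_eq, Complex.ofReal_re]
  rw [h2]
  exact Complex.reCLM.contDiff.comp h1

theorem fourierCoef_smoothForcing_zero {α : ℝ} (hα : 0 < α) {l : ℝ} (hl0 : 0 ≤ l) (hl1 : l ≤ 1) :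
    fourierCoef (smoothForcing α l) 0 = (l : ℂ) := by
  rw [fourierCoef_smoothForcing hα, fourierCoef_blockForcing hl0 hl1]
  simp

theorem fourierCoef_smoothForcing_of_ne_zero {α : ℝ} (hα : 0 < α) {l : ℝ} (hl0 : 0 ≤ l)
    (hl1 : l ≤ 1) {k : ℤ} (hk : k ≠ 0) :
    fourierCoef (smoothForcing α l) k =
      Complex.exp (-((Real.pi : ℂ) ^ 2 * (k : ℂ) ^ 2 / (α : ℂ))) *
        (Complex.I / (2 * (Real.pi : ℂ) * (k : ℂ))) *
          (Complex.exp (-(2 * (Real.pi : ℂ) * Complex.I * (k : ℂ) * (l : ℂ))) - 1) := by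
  have hk' : (k : ℂ) ≠ 0 := by exact_mod_cast hk
  have hpi : (Real.pi : ℂ) ≠ 0 := by exact_mod_cast Real.pi_ne_zero
  have h1 : -(2 * (Real.pi : ℂ) * Complex.I * k) ≠ 0 :=
    neg_ne_zero.2 (mul_ne_zero Complex.two_pi_I_ne_zero hk')
  rw [fourierCoef_smoothForcing hα, fourierCoef_blockForcing hl0 hl1]
  have h2 : ∀ t : ℝ, -(2 * (Real.pi : ℂ) * Complex.I * k * t) =
      -(2 * (Real.pi : ℂ) * Complex.I * k) * t := fun t => by ring
  simp only [h2]
  rw [integral_exp_mul_complex h1, mul_assoc (Complex.exp _)]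
  congr 1
  simp only [Complex.ofReal_zero, mul_zero, Complex.exp_zero]
  rw [div_eq_iff h1]
  field_simp
  rw [Complex.I_sq]
  ring

/-! ### Centring, and the theorem. -/

/-- The averaged term does not see the means of `f` and `g`. -/
theorem averagedTerm_sub_mean {p q : ℕ} (hp : 0 < p) (hq : 0 < q) {f g : ℝ → ℝ}
    (hf : Continuous f) (hfp : Function.Periodic f 1) (hg : Continuous g) (c η ε u : ℝ) :
    averagedTerm p q (fun x => f x - ∫ t in (0 : ℝ)..1, f t) (fun y => g y - c) η ε u =
      averagedTerm p q f g η ε u := by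
  unfold averagedTerm
  set f₀ := ∫ t in (0 : ℝ)..1, f t with hf₀
  have h0 : ∫ t in (0 : ℝ)..1, (f t - f₀) = 0 := by
    rw [intervalIntegral.integral_sub (hf.intervalIntegrable _ _) intervalIntegrable_const]
    simp [hf₀]
  have hfs : Continuous fun x => f x - f₀ := by fun_prop
  have h1 : ∫ t in (0 : ℝ)..1, (f t - f₀) * (f t - f₀) = ∫ t in (0 : ℝ)..1, f t * (f t - f₀) := by
    have h2 : ∫ t in (0 : ℝ)..1, (f t - f₀) * (f t - f₀) =
        ∫ t in (0 : ℝ)..1, (f t * (f t - f₀) - f₀ * (f t - f₀)) :=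
      intervalIntegral.integral_congr fun t _ => by ring
    rw [h2, intervalIntegral.integral_sub, intervalIntegral.integral_const_mul, h0, mul_zero,
      sub_zero]
    · exact (hf.mul hfs).intervalIntegrable _ _
    · exact (continuous_const.mul hfs).intervalIntegrable _ _
  have h2 : orbitAvg p q (fun z => (g z.2 - c) * (f z.1 - f₀)) (u, 0) =
      orbitAvg p q (fun z => g z.2 * (f z.1 - f₀)) (u, 0) := by
    -- The shift by `c` contributes `c` times the orbit average of `f - f₀`, which is the mean of `f
    -- - f₀`, that is `0`.
    have h3 := orbitAvg_comp_fst hp hq (h := fun x => f x - f₀) (fun x => by simp only [hfp x])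
      hfs (u, 0)
    rw [h0] at h3
    have h4 : orbitAvg p q (fun z => (g z.2 - c) * (f z.1 - f₀)) (u, 0) =
        orbitAvg p q (fun z => g z.2 * (f z.1 - f₀)) (u, 0)
          - c * orbitAvg p q (fun z => f z.1 - f₀) (u, 0) := by
      simp only [orbitAvg]
      rw [mul_left_comm c, ← mul_sub, ← intervalIntegral.integral_const_mul c,
        ← intervalIntegral.integral_sub]
      · congr 1
        refine intervalIntegral.integral_congr fun s _ => ?_
        ring
      · refine Continuous.intervalIntegrable ?_ _ _
        fun_prop
      · refine Continuous.intervalIntegrable ?_ _ _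
        fun_prop
    rw [h4, h3, mul_zero, sub_zero]
  simp only [h0, sub_zero, h1, h2]

theorem theorem1 (p q : ℕ) (hp : 0 < p) (hq : 0 < q) (hpq : Nat.Coprime p q)
    (f : ℝ → ℝ) (hf : ContDiff ℝ ∞ f) (hper : Function.Periodic f 1)
    (α : ℝ) (hα : 0 < α) (l : ℝ) (hl0 : 0 ≤ l) (hl1 : l ≤ 1) :
    -- the Fourier coefficients of the forcing
    fourierCoef (smoothForcing α l) 0 = (l : ℂ) ∧
    (∀ k : ℤ, k ≠ 0 →
      fourierCoef (smoothForcing α l) k =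
        Complex.exp (-((Real.pi : ℂ) ^ 2 * (k : ℂ) ^ 2 / (α : ℂ))) *
          (Complex.I / (2 * (Real.pi : ℂ) * (k : ℂ))) *
            (Complex.exp (-(2 * (Real.pi : ℂ) * Complex.I * (k : ℂ) * (l : ℂ))) - 1)) ∧
    -- the series converge absolutely
    Summable (fun k : {k : ℤ // k ≠ 0} => fourierCoef f k * fourierCoef f (-k)) ∧
    (∀ u : ℝ, Summable (fun m : {m : ℤ // m ≠ 0} =>
      fourierCoef f (m * q) * fourierCoef (smoothForcing α l) (-(m * p)) *
        Complex.exp (2 * (Real.pi : ℂ) * Complex.I * (m : ℂ) * (q : ℂ) * (u : ℂ)))) ∧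
    ∃ W : ℝ → ℝ → ℝ → ℝ,
      (∀ η ε u : ℝ, (W η ε u : ℂ) =
        -((q : ℂ) / (p : ℂ)) *
          ((η : ℂ) ^ 2 * ∑' k : {k : ℤ // k ≠ 0}, fourierCoef f k * fourierCoef f (-k)
            + (ε : ℂ) * (η : ℂ) * ∑' m : {m : ℤ // m ≠ 0},
              fourierCoef f (m * q) * fourierCoef (smoothForcing α l) (-(m * p)) *
                Complex.exp (2 * (Real.pi : ℂ) * Complex.I * (m : ℂ) * (q : ℂ) * (u : ℂ)))) ∧
      -- the means of `f` and of the forcing are absorbed in the frequency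
      IsVectorFieldApprox p q
        (fun P x y => (p : ℝ) / q + P.1 + P.2.1 * (f x - ∫ t in (0 : ℝ)..1, f t)
          + P.2.2 * (smoothForcing α l y - l))
        (fun P u => P.1 + W P.2.1 P.2.2 u) ∧
      -- the means are not absorbed in the frequency
      IsVectorFieldApprox p q
        (fun P x y => (p : ℝ) / q + P.1 + P.2.1 * f x + P.2.2 * smoothForcing α l y)
        (fun P u => P.1 + P.2.1 * (∫ t in (0 : ℝ)..1, f t) + P.2.2 * l
          + W P.2.1 P.2.2 u) := by
  have hgs := contDiff_smoothForcing hα l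
  have hgp := periodic_smoothForcing α l
  have hg0 := fourierCoef_smoothForcing_zero hα hl0 hl1
  have hM := hasSum_fourierCoef_mul_fourierCoef_neg hf hper
  have hR := hasSum_resonant hq hpq hf hper hgs.continuous hgp
  have hmean : ∫ t in (0 : ℝ)..1, smoothForcing α l t = l := by
    rw [fourierCoef_zero] at hg0
    exact_mod_cast hg0
  -- Taking for `W` the real expression in orbit averages makes its reality automatic; the series
  -- are then evaluations of it.
  refine ⟨hg0, fun k hk => fourierCoef_smoothForcing_of_ne_zero hα hl0 hl1 hk, hM.summable,
    fun u => (hR u).summable, averagedTerm p q f (smoothForcing α l), fun η ε u => ?_, ?_, ?_⟩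
  · rw [hM.tsum_eq, (hR u).tsum_eq, averagedTerm]
    push_cast
    ring
  · have h := isVectorFieldApprox_averagedTerm hp hq hpq
      (f := fun x => f x - ∫ t in (0 : ℝ)..1, f t) (g := fun y => smoothForcing α l y - l)
      (hf.sub contDiff_const) (fun x => by simp only [hper x]) (hgs.sub contDiff_const)
      (fun y => by simp only [hgp y])
    simp only [averagedTerm_sub_mean hp hq hf.continuous hper hgs.continuous] at h
    have h1 : ∫ t in (0 : ℝ)..1, (f t - ∫ t in (0 : ℝ)..1, f t) = 0 := by
      rw [intervalIntegral.integral_sub (hf.continuous.intervalIntegrable _ _)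
        intervalIntegrable_const]
      simp
    have h2 : ∫ t in (0 : ℝ)..1, (smoothForcing α l t - l) = 0 := by
      rw [intervalIntegral.integral_sub (hgs.continuous.intervalIntegrable _ _)
        intervalIntegrable_const, hmean]
      simp
    simpa only [h1, h2, mul_zero, add_zero] using h
  · have h := isVectorFieldApprox_averagedTerm hp hq hpq hf hper hgs hgp
    simpa only [hmean] using h
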